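/- Let $0<\alpha<1$, $T>0$, $\eta\in\mathbb R^m$. For a continuous $g$ on $[0,T]$ the Caputo derivative of order $\alpha$ is $$D^\alpha g(t)=\frac{\mathrm d}{\mathrm dt}\,\frac1{\Gamma(1-\alpha)}\int_0^t (t-x)^{-\alpha}\,[g(x)-g(0)]\,\mathrm dx$$ whenever the derivative exists (one-sided at $0$ and $T$); for absolutely continuous $g$ it agrees almost everywhere with $\frac1{\Gamma(1-\alpha)}\int_0^t (t-x)^{-\alpha}g'(x)\,\mathrm dx$. Let $f=f(t,y)\in\mathbb R^m$. Denote by $y(\cdot,\rho)$ the continuous solution of the initial value problem $$D^\alpha y(t)=f(t,y(t)),\quad t\in[0,T],\qquad y(0)=\rho,$$ and by $\Phi(\cdot,\rho)$ the continuous solution of the variational problem $$D^\alpha\Phi(t,\rho)=f'(t,y(t,\rho))\,\Phi(t,\rho),\quad t\in[0,T],\qquad \Phi(0,\rho)=I,$$ where $f'$ is the Jacobian matrix of $f$ with respect to $y$. Suppose that the terminal value problem $D^\alpha y=f(t,y)$ on $[0,T]$, $y(T)=\eta$, has a solution $y(\cdot,\rho^*)$, with initial value $\rho^*$, so that $y(T,\rho^*)=\eta$.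 Assume that: 1. $f$ is continuous, and is differentiable with respect to $y$ with $f'$ continuous in $(t,y)$, in a neighborhood (relative to $[0,T]\times\mathbb R^m$) of the graph $\{(t,y(t,\rho^*)):t\in[0,T]\}$; 2. for all $\xi$ in a neighborhood of $\rho^*$ the matrix $\Phi(T,\xi)$ is invertible, and $\xi\mapsto\Phi(T,\xi)^{-1}$ is differentiable there; 3. $\xi\mapsto\hat\Phi(T,\xi)\in\mathbb R^{m\times m}$ is a matrix function such that, for all $\xi$ in a neighborhood of $\rho^*$, $\hat\Phi(T,\xi)$ is invertible, and $\xi\mapsto\hat\Phi(T,\xi)^{-1}$ is continuous there; 4. the spectral radius (the largest modulus of a complex eigenvalue) of $I-\hat\Phi(T,\rho^*)^{-1}\Phi(T,\rho^*)$ is less than $1$. Then there is a neighborhood $U$ of $\rho^*$ such that for every $\rho_0\in U$ the simplified shooting-Newton iteration $$\rho_{\ell+1}=\rho_\ell-\hat\Phi(T,\rho_\ell)^{-1}\,[\,y(T,\rho_\ell)-\eta\,],\qquad \ell=0,1,2,\dots,$$ is well defined (for every $\ell$ the initial value problem with $\rho=\rho_\ell$ has exactly one solution on $[0,T]$ and $\hat\Phi(T,\rho_\ell)$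 is invertible) and $\rho_\ell\to\rho^*$ as $\ell\to\infty$. -/

import Mathlib

open Set Filter Topology Matrix

noncomputable section

namespace FracTVP

/-- The Riemann–Liouville integral of order `β`,
`I^β g(t) = (1 / Γ(β)) ∫₀ᵗ (t - x)^(β - 1) g(x) dx`. -/
def rlIntegral {F : Type*} [NormedAddCommGroup F] [NormedSpace ℝ F]
    (β : ℝ) (g : ℝ → F) (t : ℝ) : F :=
  (Real.Gamma β)⁻¹ • ∫ x in (0 : ℝ)..t, (t - x) ^ (β - 1) • g x

/-- `g` is continuous on `[0, T]` and has there the Caputo derivative `D^α g = g'`, where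
`D^α g = d/dt I^(1 - α) (g - g 0)` (one-sided derivative at the end points).
This is the usual definition for continuous functions, `0 < α < 1`; if `g` is absolutely
continuous, then `I^(1 - α) (g - g 0) = I^1 (I^(1 - α) (dg/dx))`, so `D^α g(t)` is
`(1 / Γ(1 - α)) ∫₀ᵗ (t - x)^(-α) (dg/dx)(x) dx`. -/
def HasCaputoDerivOn {F : Type*} [NormedAddCommGroup F] [NormedSpace ℝ F]
    (α T : ℝ) (g g' : ℝ → F) : Prop :=
  ContinuousOn g (Icc 0 T) ∧
    ∀ t ∈ Icc 0 T,
      HasDerivWithinAt (rlIntegral (1 - α) (fun x => g x - g 0)) (g' t) (Icc 0 T) t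

variable {m : ℕ}

/-- `y` solves the initial value problem `D^α y(t) = f(t, y(t))`, `t ∈ [0, T]`, `y(0) = ρ`. -/
def IsIVPSolution (α T : ℝ) (f : ℝ → (Fin m → ℝ) → (Fin m → ℝ)) (ρ : Fin m → ℝ)
    (y : ℝ → (Fin m → ℝ)) : Prop :=
  y 0 = ρ ∧ HasCaputoDerivOn α T y (fun t => f t (y t))

/-- The initial value problem has a solution, and only one on `[0, T]`. -/
def UniquelySolvable (α T : ℝ) (f : ℝ → (Fin m → ℝ) → (Fin m → ℝ)) (ρ : Fin m → ℝ) : Prop :=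
  ∃ y, IsIVPSolution α T f ρ y ∧ ∀ z, IsIVPSolution α T f ρ z → EqOn z y (Icc 0 T)

open Classical in
/-- `t ↦ y(t, ρ)`: a solution of the initial value problem (`0` if there is none). -/
def ivpSolution (α T : ℝ) (f : ℝ → (Fin m → ℝ) → (Fin m → ℝ)) (ρ : Fin m → ℝ) :
    ℝ → (Fin m → ℝ) :=
  if h : ∃ y, IsIVPSolution α T f ρ y then h.choose else 0

/-- The Jacobian matrix of `g` at `v`. -/
def jacobian (g : (Fin m → ℝ) → (Fin m → ℝ)) (v : Fin m → ℝ) : Matrix (Fin m) (Fin m) ℝ :=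
  LinearMap.toMatrix' (fderiv ℝ g v : (Fin m → ℝ) →ₗ[ℝ] (Fin m → ℝ))

/-- `Φ` solves the matrix problem `D^α Φ(t) = A(t) Φ(t)`, `t ∈ [0, T]`, `Φ(0) = I`
(the Caputo derivative of a matrix function is taken entrywise). -/
def IsFundamentalMatrix (α T : ℝ) (A Φ : ℝ → Matrix (Fin m) (Fin m) ℝ) : Prop :=
  Φ 0 = 1 ∧ ∀ i j, HasCaputoDerivOn α T (fun t => Φ t i j) (fun t => (A t * Φ t) i j)

open Classical in
/-- `t ↦ Φ(t, ρ)`: a solution of the variational problem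
`D^α Φ(t, ρ) = f'(t, y(t, ρ)) Φ(t, ρ)`, `Φ(0, ρ) = I` (`0` if there is none). -/
def variationalSolution (α T : ℝ) (f : ℝ → (Fin m → ℝ) → (Fin m → ℝ)) (ρ : Fin m → ℝ) :
    ℝ → Matrix (Fin m) (Fin m) ℝ :=
  if h : ∃ Φ, IsFundamentalMatrix α T (fun t => jacobian (f t) (ivpSolution α T f ρ t)) Φ
  then h.choose else 0

/-- In a neighbourhood (relative to `[0, T] × ℝᵐ`) of the graph of `y` over `[0, T]`, the
function `f` is continuous and continuously differentiable with respect to its vector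
argument. -/
def ContDiffNearSolution (T : ℝ) (f : ℝ → (Fin m → ℝ) → (Fin m → ℝ))
    (y : ℝ → (Fin m → ℝ)) : Prop :=
  ∃ U : Set (ℝ × (Fin m → ℝ)), IsOpen U ∧ (∀ t ∈ Icc 0 T, (t, y t) ∈ U) ∧
    ContinuousOn (fun p : ℝ × (Fin m → ℝ) => f p.1 p.2) (U ∩ Icc 0 T ×ˢ univ) ∧
    (∀ p ∈ U ∩ Icc 0 T ×ˢ univ, DifferentiableAt ℝ (f p.1) p.2) ∧
    ContinuousOn (fun p : ℝ × (Fin m → ℝ) => jacobian (f p.1) p.2) (U ∩ Icc 0 T ×ˢ univ)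

/-- The spectral radius of a real matrix: the largest modulus of its complex eigenvalues. -/
def realMatrixSpectralRadius (A : Matrix (Fin m) (Fin m) ℝ) : ENNReal :=
  spectralRadius ℂ (A.map (algebraMap ℝ ℂ))

end FracTVP

end

/-! The iteration is the orbit of `G ξ = ξ - (Φhat ξ)⁻¹ *ᵥ (y(T, ξ) - η)`, and `ρstar` is a fixed
point of `G`. By Ostrowski's argument a fixed point attracts its neighbourhood once `G` is
differentiable there with derivative of spectral radius below one: Gelfand's formula gives a power
`k` of the derivative with norm below one, so `G^[k]` contracts towards the point
(`eventually_iterate_tendsto_of_norm_pow_lt_one`). Since the residual vanishes at `ρstar`, only the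
value of `Φhat⁻¹` there enters the derivative, which is `1 - Φhat⁻¹ * Φ(T)`
(`hasFDerivAt_sub_mulVec`).

What remains is that `ξ ↦ y(T, ξ)` has derivative `Φ(T, ρstar)` at `ρstar`
(`hasFDerivAt_terminal_value`). For a continuous right-hand side the Caputo problem is the Volterra
equation `y = ρ + I^α f(·, y)`, because `I^α I^(1 - α) = I^1`. In the weight `exp (c t)` the
operator `I^α` has norm at most `c ^ (-α)`, which is small for large `c`; this yields both a
contraction for existence and a Gronwall inequality.

As `f` is controlled only near one graph, the analysis takes place in a compact tube: truncating `f`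
gives existence, and a first-exit argument shows that every solution starting nearby stays in the
tube, hence uniqueness. Finally `z - y - Φ (ρ - ρstar)` solves a linearized equation with forcing
`o(‖ρ - ρstar‖)`, and Gronwall concludes. -/

namespace FracTVP

open MeasureTheory

/-! ### Riemann–Liouville integrals: weighted bounds, continuity, composition. -/

section RLIntegral

variable {E : Type*} [NormedAddCommGroup E] [NormedSpace ℝ E]

theorem intervalIntegrable_sub_rpow {β : ℝ} (hβ : 0 < β) (a b t : ℝ) :
    IntervalIntegrable (fun x => (t - x) ^ (β - 1)) volume a b := by
  have h := (intervalIntegral.intervalIntegrable_rpow' (a := t - a) (b := t - b) (r := β - 1)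
    (by linarith)).comp_sub_left t
  simpa using h

theorem intervalIntegrable_rlKernel_smul {β : ℝ} (hβ : 0 < β) {t : ℝ} (ht : 0 ≤ t) {g : ℝ → E}
    (hg : ContinuousOn g (Icc 0 t)) :
    IntervalIntegrable (fun x => (t - x) ^ (β - 1) • g x) volume 0 t :=
  (intervalIntegrable_sub_rpow hβ 0 t t).smul_continuousOn (by rwa [uIcc_of_le ht])

theorem rlIntegral_congr {β t : ℝ} (ht : 0 ≤ t) {g h : ℝ → E} (hgh : EqOn g h (Icc 0 t)) :
    rlIntegral β g t = rlIntegral β h t := by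
  unfold rlIntegral
  congr 1
  refine intervalIntegral.integral_congr fun x hx => ?_
  rw [uIcc_of_le ht] at hx
  simp only [hgh hx]

theorem rlIntegral_sub {β t : ℝ} (hβ : 0 < β) (ht : 0 ≤ t) {g h : ℝ → E}
    (hg : ContinuousOn g (Icc 0 t)) (hh : ContinuousOn h (Icc 0 t)) :
    rlIntegral β (fun x => g x - h x) t = rlIntegral β g t - rlIntegral β h t := by
  simp only [rlIntegral, smul_sub]
  rw [intervalIntegral.integral_sub (intervalIntegrable_rlKernel_smul hβ ht hg)
    (intervalIntegrable_rlKernel_smul hβ ht hh), smul_sub]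

theorem rlIntegral_clm_comp {F : Type*} [NormedAddCommGroup F] [NormedSpace ℝ F]
    [CompleteSpace E] [CompleteSpace F] {β t : ℝ} (hβ : 0 < β) (ht : 0 ≤ t) {g : ℝ → E}
    (hg : ContinuousOn g (Icc 0 t)) (A : E →L[ℝ] F) :
    rlIntegral β (fun x => A (g x)) t = A (rlIntegral β g t) := by
  simp only [rlIntegral, ← map_smul]
  rw [A.intervalIntegral_comp_comm (intervalIntegrable_rlKernel_smul hβ ht hg), map_smul]

theorem rlIntegral_zero_right (β : ℝ) (g : ℝ → E) : rlIntegral β g 0 = 0 := by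
  simp [rlIntegral]

/-- Substituting `u = t - x` pulls out `exp (c t)` and leaves a Gamma integral cut off at `t`. -/
theorem integral_sub_rpow_mul_exp_le {β c t : ℝ} (hβ : 0 < β) (hc : 0 < c) (ht : 0 ≤ t) :
    ∫ x in (0 : ℝ)..t, (t - x) ^ (β - 1) * Real.exp (c * x) ≤
      Real.Gamma β * c ^ (-β) * Real.exp (c * t) := by
  have h1 : ∫ x in (0 : ℝ)..t, (t - x) ^ (β - 1) * Real.exp (c * x) =
      Real.exp (c * t) * ∫ u in (0 : ℝ)..t, u ^ (β - 1) * Real.exp (-(c * u)) := by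
    have := intervalIntegral.integral_comp_sub_left (a := 0) (b := t)
      (fun u => Real.exp (c * t) * (u ^ (β - 1) * Real.exp (-(c * u)))) t
    rw [sub_self, sub_zero] at this
    rw [← intervalIntegral.integral_const_mul, ← this]
    refine intervalIntegral.integral_congr fun x _ => ?_
    have : Real.exp (c * x) = Real.exp (c * t) * Real.exp (-(c * (t - x))) := by
      rw [← Real.exp_add]; ring_nf
    simp only [this]; ring
  have h2 : ∫ u in (0 : ℝ)..t, u ^ (β - 1) * Real.exp (-(c * u)) ≤ Real.Gamma β * c ^ (-β) := by
    have h3 := Real.integral_rpow_mul_exp_neg_mul_Ioi hβ hc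
    have h4 : (1 / c) ^ β = c ^ (-β) := by
      rw [one_div, Real.inv_rpow hc.le, Real.rpow_neg hc.le]
    rw [mul_comm (Real.Gamma β), ← h4, ← h3, intervalIntegral.integral_of_le ht]
    refine setIntegral_mono_set ?_ ?_ (Ioc_subset_Ioi_self.eventuallyLE)
    -- A non-integrable function would have integral `0`, but this one equals a positive number.
    · refine Integrable.of_integral_ne_zero ?_
      rw [h3]
      have := Real.Gamma_pos_of_pos hβ
      positivity
    · filter_upwards [ae_restrict_mem measurableSet_Ioi] with u hu
      have : (0 : ℝ) < u := hu
      simp only [Pi.zero_apply]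
      positivity
  rw [h1]
  nlinarith [Real.exp_pos (c * t)]

/-- A weighted estimate: the Riemann–Liouville integral of order `β` gains a factor `c ^ (-β)`
in the scale of functions of growth `exp (c t)`. -/
theorem norm_rlIntegral_le_of_norm_le_exp {β c t M : ℝ} (hβ : 0 < β) (hc : 0 < c) (ht : 0 ≤ t)
    {g : ℝ → E} (hM : 0 ≤ M) (hg : ∀ x ∈ Icc 0 t, ‖g x‖ ≤ M * Real.exp (c * x)) :
    ‖rlIntegral β g t‖ ≤ M * c ^ (-β) * Real.exp (c * t) := by
  have hΓ := Real.Gamma_pos_of_pos hβ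
  have h1 : ‖∫ x in (0 : ℝ)..t, (t - x) ^ (β - 1) • g x‖ ≤
      ∫ x in (0 : ℝ)..t, M * ((t - x) ^ (β - 1) * Real.exp (c * x)) := by
    refine intervalIntegral.norm_integral_le_of_norm_le ht (Eventually.of_forall fun x hx => ?_) ?_
    · have h0 : 0 ≤ (t - x) ^ (β - 1) := Real.rpow_nonneg (by linarith [hx.2]) _
      rw [norm_smul, Real.norm_of_nonneg h0]
      nlinarith [hg x ⟨hx.1.le, hx.2⟩]
    · refine ((intervalIntegrable_sub_rpow hβ 0 t t).mul_continuousOn ?_).const_mul M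
      fun_prop
  rw [intervalIntegral.integral_const_mul] at h1
  rw [rlIntegral, norm_smul, norm_inv, Real.norm_of_nonneg hΓ.le, inv_mul_le_iff₀ hΓ]
  refine h1.trans ?_
  have := mul_le_mul_of_nonneg_left (integral_sub_rpow_mul_exp_le hβ hc ht) hM
  linarith

/-- The rescaling `x = t s` turns the integral into `t ^ β` times one over `[0, 1]` whose singular
kernel no longer depends on `t`, so dominated convergence applies. -/
theorem continuousOn_rlIntegral {β : ℝ} (hβ : 0 < β) {g : ℝ → E} {T : ℝ} (hT : 0 ≤ T)
    (hg : ContinuousOn g (Icc 0 T)) : ContinuousOn (rlIntegral β g) (Icc 0 T) := by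
  -- Extending by the end values makes the integrand continuous and bounded on the whole line.
  set G : ℝ → E := fun t => g (projIcc 0 T hT t) with hG
  have hGc : Continuous G := hg.comp_continuous (by fun_prop) (fun t => (projIcc 0 T hT t).2)
  have hGg : EqOn g G (Icc 0 T) := fun t ht => by simp [hG, projIcc_of_mem hT ht]
  obtain ⟨M, hM⟩ : ∃ M, ∀ t, ‖G t‖ ≤ M := by
    obtain ⟨M, hM⟩ := isCompact_Icc.exists_bound_of_continuousOn hg
    exact ⟨M, fun t => hM _ (projIcc 0 T hT t).2⟩
  have hcont : Continuous fun t : ℝ => ∫ s in (0 : ℝ)..1, (1 - s) ^ (β - 1) • G (t * s) := by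
    refine intervalIntegral.continuous_of_dominated_interval
      (bound := fun s => (1 - s) ^ (β - 1) * M) (fun t => ?_) (fun t => ?_) ?_ ?_
    · exact (by fun_prop : Measurable fun s : ℝ => (1 - s) ^ (β - 1)).aestronglyMeasurable.smul
        (by fun_prop : Continuous fun s => G (t * s)).aestronglyMeasurable
    · refine Eventually.of_forall fun s hs => ?_
      rw [uIoc_of_le zero_le_one] at hs
      have h0 : 0 ≤ (1 - s) ^ (β - 1) := Real.rpow_nonneg (by linarith [hs.2]) _
      rw [norm_smul, Real.norm_of_nonneg h0]
      exact mul_le_mul_of_nonneg_left (hM _) h0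
    · exact (intervalIntegrable_sub_rpow hβ 0 1 1).mul_const M
    · exact Eventually.of_forall fun s _ => by fun_prop
  have hrpow : Continuous fun t : ℝ => t ^ β := Real.continuous_rpow_const hβ.le
  refine ((hrpow.smul hcont).const_smul (Real.Gamma β)⁻¹).continuousOn.congr fun t ht => ?_
  rw [rlIntegral_congr ht.1 (hGg.mono (Icc_subset_Icc_right ht.2)), rlIntegral]
  congr 1
  rcases ht.1.eq_or_lt with rfl | h0
  · simp [Real.zero_rpow hβ.ne']
  have h1 := intervalIntegral.smul_integral_comp_mul_left (a := 0) (b := 1)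
    (fun x => (t - x) ^ (β - 1) • G x) t
  rw [mul_zero, mul_one] at h1
  rw [← h1]
  have h2 : t ^ β = t * t ^ (β - 1) := by
    rw [← Real.rpow_one_add' h0.le (by linarith)]; ring_nf
  have h3 : ∫ s in (0 : ℝ)..1, (t - t * s) ^ (β - 1) • G (t * s) =
      t ^ (β - 1) • ∫ s in (0 : ℝ)..1, (1 - s) ^ (β - 1) • G (t * s) := by
    rw [← intervalIntegral.integral_smul]
    refine intervalIntegral.integral_congr fun s hs => ?_
    rw [uIcc_of_le zero_le_one] at hs
    have h4 : t - t * s = t * (1 - s) := by ring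
    simp only [h4, Real.mul_rpow h0.le (sub_nonneg.2 hs.2), mul_smul]
  simp only [Pi.smul_apply', h3, h2, mul_smul]

/-- This is the Beta integral `B(1 - a, a)`; the exponents sum to one, so the scaling factor `(t -
s) ^ 0` and `Γ(1)` both drop out and the value is independent of `s` and `t`. -/
theorem integral_beta_kernel {a : ℝ} (ha0 : 0 < a) (ha1 : a < 1) {s t : ℝ} (hst : s < t) :
    ∫ x in s..t, (t - x) ^ (a - 1) * (x - s) ^ (1 - a - 1) = Real.Gamma a * Real.Gamma (1 - a) := by
  have h1 := Complex.betaIntegral_scaled ((1 - a : ℝ) : ℂ) (a : ℂ) (sub_pos.2 hst)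
  have h2 := Complex.Gamma_mul_Gamma_eq_betaIntegral (s := ((1 - a : ℝ) : ℂ)) (t := (a : ℂ))
    (by simpa using ha1) (by simpa using ha0)
  have h3 : ((1 - a : ℝ) : ℂ) + (a : ℂ) = 1 := by push_cast; ring
  rw [h3, sub_self, Complex.cpow_zero, one_mul] at h1
  rw [h3, Complex.Gamma_one, one_mul] at h2
  have h4 := intervalIntegral.integral_comp_sub_right (a := s) (b := t)
    (fun u => (t - s - u) ^ (a - 1) * u ^ (1 - a - 1)) s
  rw [sub_self] at h4
  have h5 : ∫ x in s..t, (t - x) ^ (a - 1) * (x - s) ^ (1 - a - 1) =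
      ∫ x in s..t, (t - s - (x - s)) ^ (a - 1) * (x - s) ^ (1 - a - 1) := by
    simp only [sub_sub_sub_cancel_right]
  rw [h5, h4, ← Complex.ofReal_inj, Complex.ofReal_mul, ← Complex.Gamma_ofReal,
    ← Complex.Gamma_ofReal, mul_comm, h2, ← h1, ← intervalIntegral.integral_ofReal]
  refine intervalIntegral.integral_congr fun u hu => ?_
  rw [uIcc_of_le (sub_nonneg.2 hst.le)] at hu
  simp only [Complex.ofReal_mul]
  rw [Complex.ofReal_cpow (sub_nonneg.2 hu.2), Complex.ofReal_cpow hu.1]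
  push_cast
  ring

theorem intervalIntegrable_beta_kernel {a : ℝ} (ha0 : 0 < a) (ha1 : a < 1) {s t : ℝ}
    (hst : s < t) :
    IntervalIntegrable (fun x => (t - x) ^ (a - 1) * (x - s) ^ (1 - a - 1)) volume s t := by
  by_contra h
  have h1 := integral_beta_kernel ha0 ha1 hst
  rw [intervalIntegral.integral_undef h] at h1
  exact (mul_pos (Real.Gamma_pos_of_pos ha0) (Real.Gamma_pos_of_pos (sub_pos.2 ha1))).ne h1

/-- The integrand of the iterated integral `I^a I^(1 - a) g`, over the triangle `s ≤ x`. -/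
noncomputable def triangleIntegrand (a t : ℝ) (g : ℝ → E) (x s : ℝ) : E :=
  (Iic x).indicator (fun s => ((t - x) ^ (a - 1) * (x - s) ^ (1 - a - 1)) • g s) s

theorem triangleIntegrand_eq_indicator_Ici (a t : ℝ) (g : ℝ → E) (x s : ℝ) :
    triangleIntegrand a t g x s =
      (Ici s).indicator (fun x => ((t - x) ^ (a - 1) * (x - s) ^ (1 - a - 1)) • g s) x := by
  simp only [triangleIntegrand, indicator, mem_Iic, mem_Ici]

theorem restrict_Ioc_restrict_Ici {s t : ℝ} (hs : s ∈ Ioc 0 t) :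
    (volume.restrict (Ioc (0 : ℝ) t)).restrict (Ici s) = volume.restrict (Ioc s t) := by
  rw [Measure.restrict_restrict measurableSet_Ici, inter_comm]
  have : Ioc 0 t ∩ Ici s = Icc s t := by
    ext x; simp only [mem_inter_iff, mem_Ioc, mem_Ici, mem_Icc]
    exact ⟨fun h => ⟨h.2, h.1.2⟩, fun h => ⟨⟨hs.1.trans_le h.1, h.2⟩, h.1⟩⟩
  rw [this, restrict_Ioc_eq_restrict_Icc]

theorem integrable_triangleIntegrand_left {a : ℝ} (ha0 : 0 < a) (ha1 : a < 1) {t s : ℝ}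
    (hs : s ∈ Ioo 0 t) (g : ℝ → E) :
    Integrable (fun x => triangleIntegrand a t g x s) (volume.restrict (Ioc 0 t)) := by
  simp only [triangleIntegrand_eq_indicator_Ici]
  rw [integrable_indicator_iff measurableSet_Ici, IntegrableOn,
    restrict_Ioc_restrict_Ici ⟨hs.1, hs.2.le⟩]
  exact (intervalIntegrable_beta_kernel ha0 ha1 hs.2).1.smul_const (g s)

theorem integral_triangleIntegrand_left [CompleteSpace E] {a : ℝ} (ha0 : 0 < a) (ha1 : a < 1)
    {t s : ℝ} (hs : s ∈ Ioo 0 t) (g : ℝ → E) :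
    ∫ x in Ioc 0 t, triangleIntegrand a t g x s =
      (Real.Gamma a * Real.Gamma (1 - a)) • g s := by
  simp only [triangleIntegrand_eq_indicator_Ici]
  rw [integral_indicator measurableSet_Ici, restrict_Ioc_restrict_Ici ⟨hs.1, hs.2.le⟩,
    integral_smul_const, ← intervalIntegral.integral_of_le hs.2.le,
    integral_beta_kernel ha0 ha1 hs.2]

theorem integral_norm_triangleIntegrand_left {a : ℝ} (ha0 : 0 < a) (ha1 : a < 1)
    {t s : ℝ} (hs : s ∈ Ioo 0 t) (g : ℝ → E) :
    ∫ x in Ioc 0 t, ‖triangleIntegrand a t g x s‖ =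
      (Real.Gamma a * Real.Gamma (1 - a)) * ‖g s‖ := by
  rw [← smul_eq_mul, ← integral_triangleIntegrand_left ha0 ha1 hs (fun s => ‖g s‖)]
  refine setIntegral_congr_fun measurableSet_Ioc fun x hx => ?_
  simp only [triangleIntegrand, indicator, mem_Iic]
  split_ifs with h
  · have h1 : 0 ≤ (t - x) ^ (a - 1) * (x - s) ^ (1 - a - 1) :=
      mul_nonneg (Real.rpow_nonneg (sub_nonneg.2 hx.2) _) (Real.rpow_nonneg (sub_nonneg.2 h) _)
    rw [norm_smul, Real.norm_of_nonneg h1, smul_eq_mul]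
  · exact norm_zero

/-- The endpoint `s = t`, where the Beta kernel degenerates, is a null set. -/
theorem ae_restrict_Ioc_mem_Ioo (t : ℝ) : ∀ᵐ s ∂volume.restrict (Ioc (0 : ℝ) t), s ∈ Ioo 0 t := by
  rw [← restrict_Ioo_eq_restrict_Ioc]
  exact ae_restrict_mem measurableSet_Ioo

/-- Tonelli: integrating the norm over `x` first leaves a constant times `‖g s‖`. This licenses the
exchange of integrals in `I^a I^(1 - a) g`. -/
theorem integrable_triangleIntegrand {a : ℝ} (ha0 : 0 < a) (ha1 : a < 1) {t : ℝ}
    {g : ℝ → E} (hg : ContinuousOn g (Icc 0 t)) :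
    Integrable (Function.uncurry (triangleIntegrand a t g))
      ((volume.restrict (Ioc 0 t)).prod (volume.restrict (Ioc 0 t))) := by
  have hgi : Integrable g (volume.restrict (Ioc 0 t)) :=
    (hg.integrableOn_compact isCompact_Icc).mono_set Ioc_subset_Icc_self
  rw [integrable_prod_iff']
  · refine ⟨?_, ?_⟩
    · filter_upwards [ae_restrict_Ioc_mem_Ioo t] with s hs
      exact integrable_triangleIntegrand_left ha0 ha1 hs g
    · refine (hgi.norm.const_mul (Real.Gamma a * Real.Gamma (1 - a))).congr ?_
      filter_upwards [ae_restrict_Ioc_mem_Ioo t] with s hs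
      exact (integral_norm_triangleIntegrand_left ha0 ha1 hs g).symm
  · have : Function.uncurry (triangleIntegrand a t g) = {p : ℝ × ℝ | p.2 ≤ p.1}.indicator
        (fun p => ((t - p.1) ^ (a - 1) * (p.1 - p.2) ^ (1 - a - 1)) • g p.2) := by
      ext p; simp only [Function.uncurry, triangleIntegrand, indicator, mem_Iic, mem_ofPred_eq]
    rw [this]
    refine AEStronglyMeasurable.indicator ?_ (measurableSet_le measurable_snd measurable_fst)
    refine AEStronglyMeasurable.smul ?_ hgi.aestronglyMeasurable.comp_snd
    exact (by fun_prop : Measurable fun p : ℝ × ℝ =>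
      (t - p.1) ^ (a - 1) * (p.1 - p.2) ^ (1 - a - 1)).aestronglyMeasurable

/-- `I^a I^(1 - a) g = I^1 g`. -/
theorem rlIntegral_rlIntegral_one_sub [CompleteSpace E] {a : ℝ} (ha0 : 0 < a) (ha1 : a < 1)
    {t : ℝ} (ht : 0 ≤ t) {g : ℝ → E} (hg : ContinuousOn g (Icc 0 t)) :
    rlIntegral a (rlIntegral (1 - a) g) t = ∫ x in (0 : ℝ)..t, g x := by
  have hΓ := Real.Gamma_pos_of_pos ha0
  have hΓ' := Real.Gamma_pos_of_pos (sub_pos.2 ha1)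
  have key : ∫ x in (0 : ℝ)..t, (t - x) ^ (a - 1) •
      ∫ s in (0 : ℝ)..x, (x - s) ^ (1 - a - 1) • g s =
      (Real.Gamma a * Real.Gamma (1 - a)) • ∫ x in (0 : ℝ)..t, g x := by
    have hl : ∫ x in (0 : ℝ)..t, (t - x) ^ (a - 1) •
        ∫ s in (0 : ℝ)..x, (x - s) ^ (1 - a - 1) • g s =
        ∫ x in Ioc 0 t, ∫ s in Ioc 0 t, triangleIntegrand a t g x s := by
      rw [intervalIntegral.integral_of_le ht]
      refine setIntegral_congr_fun measurableSet_Ioc fun x hx => ?_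
      simp only [triangleIntegrand]
      rw [integral_indicator measurableSet_Iic, Measure.restrict_restrict measurableSet_Iic]
      have : Iic x ∩ Ioc 0 t = Ioc 0 x := by
        ext s; simp only [mem_inter_iff, mem_Ioc, mem_Iic]
        exact ⟨fun h => ⟨h.2.1, h.1⟩, fun h => ⟨h.2, h.1, h.2.trans hx.2⟩⟩
      rw [this, intervalIntegral.integral_of_le hx.1.le, ← integral_smul]
      simp only [mul_smul]
    rw [hl, integral_integral_swap (integrable_triangleIntegrand ha0 ha1 hg),
      intervalIntegral.integral_of_le ht, ← integral_smul]
    refine integral_congr_ae ?_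
    filter_upwards [ae_restrict_Ioc_mem_Ioo t] with s hs
    exact integral_triangleIntegrand_left ha0 ha1 hs g
  unfold rlIntegral
  simp only [smul_comm _ ((Real.Gamma (1 - a))⁻¹)]
  rw [intervalIntegral.integral_smul, key, smul_smul, smul_smul, ← mul_assoc]
  rw [show (Real.Gamma a)⁻¹ * (Real.Gamma (1 - a))⁻¹ * Real.Gamma a * Real.Gamma (1 - a) = 1 by
    field_simp, one_smul]

end RLIntegral

/-! ### Equivalence of Caputo problems and Volterra equations. -/

section Caputo

variable {E : Type*} [NormedAddCommGroup E] [NormedSpace ℝ E] [CompleteSpace E]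

theorem hasDerivWithinAt_integral_Icc {T : ℝ} (hT : 0 ≤ T) {h : ℝ → E}
    (hh : ContinuousOn h (Icc 0 T)) {t : ℝ} (ht : t ∈ Icc 0 T) :
    HasDerivWithinAt (fun t => ∫ x in (0 : ℝ)..t, h x) (h t) (Icc 0 T) t := by
  set H : ℝ → E := fun t => h (projIcc 0 T hT t) with hH
  have hHc : Continuous H := hh.comp_continuous (by fun_prop) (fun t => (projIcc 0 T hT t).2)
  have hHh : EqOn h H (Icc 0 T) := fun t ht => by simp [hH, projIcc_of_mem hT ht]
  have h1 : EqOn (fun t => ∫ x in (0 : ℝ)..t, h x) (fun t => ∫ x in (0 : ℝ)..t, H x) (Icc 0 T) := by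
    intro t ht
    refine intervalIntegral.integral_congr fun x hx => hHh ?_
    rw [uIcc_of_le ht.1] at hx
    exact ⟨hx.1, hx.2.trans ht.2⟩
  rw [hHh ht]
  refine HasDerivWithinAt.congr ?_ h1 (h1 ht)
  exact (hHc.integral_hasStrictDerivAt 0 t).hasDerivAt.hasDerivWithinAt

theorem eqOn_zero_of_integral_eq_zero {T : ℝ} (hT : 0 < T) {d : ℝ → E}
    (hd : ContinuousOn d (Icc 0 T)) (h : ∀ t ∈ Icc 0 T, ∫ x in (0 : ℝ)..t, d x = 0) :
    ∀ t ∈ Icc 0 T, d t = 0 := by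
  intro t ht
  have h1 := hasDerivWithinAt_integral_Icc hT.le hd ht
  have h2 : HasDerivWithinAt (fun t => ∫ x in (0 : ℝ)..t, d x) 0 (Icc 0 T) t :=
    (hasDerivWithinAt_const t (Icc 0 T) (0 : E)).congr h (h t ht)
  exact (uniqueDiffOn_Icc hT t ht).eq_deriv _ h1 h2

/-- Both `y - y 0` and `I^α h` have `∫ h` as their integral of order `1 - α`. That operator is
injective on continuous functions, since a further `I^α` gives the ordinary integral, which can be
differentiated. Continuity of `h` is asked only up to `τ`, as needed before a solution is known to
remain in the tube. -/
theorem HasCaputoDerivOn.eq_add_rlIntegral {α T τ : ℝ} (hα0 : 0 < α) (hα1 : α < 1)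
    (hτ : τ ≤ T) {y h : ℝ → E} (hy : HasCaputoDerivOn α T y h)
    (hh : ContinuousOn h (Icc 0 τ)) {t : ℝ} (ht : t ∈ Icc 0 τ) :
    y t = y 0 + rlIntegral α h t := by
  rcases (ht.1.trans ht.2).eq_or_lt with h0 | h0
  · obtain rfl : t = 0 := le_antisymm (h0 ▸ ht.2) ht.1
    simp [rlIntegral_zero_right]
  have hT : 0 < T := h0.trans_le hτ
  have hg : ContinuousOn (fun x => y x - y 0) (Icc 0 T) := hy.1.sub continuousOn_const
  have hJ : ∀ s ∈ Icc 0 τ, rlIntegral (1 - α) (fun x => y x - y 0) s = ∫ x in (0 : ℝ)..s, h x := by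
    intro s hs
    have hsT : Icc 0 s ⊆ Icc 0 T := Icc_subset_Icc_right (hs.2.trans hτ)
    have h1 := intervalIntegral.integral_eq_sub_of_hasDerivAt_of_le hs.1
      (f := rlIntegral (1 - α) (fun x => y x - y 0)) (f' := h)
      ((continuousOn_rlIntegral (sub_pos.2 hα1) hT.le hg).mono hsT)
      (fun x hx => (hy.2 x (hsT ⟨hx.1.le, hx.2.le⟩)).hasDerivAt
        (Icc_mem_nhds hx.1 (hx.2.trans_le (hs.2.trans hτ))))
      (ContinuousOn.intervalIntegrable (by
        rw [uIcc_of_le hs.1]; exact hh.mono (Icc_subset_Icc_right hs.2)))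
    rw [h1, rlIntegral_zero_right, sub_zero]
  have hK : ∀ s ∈ Icc 0 τ, rlIntegral (1 - α) (rlIntegral α h) s = ∫ x in (0 : ℝ)..s, h x := by
    intro s hs
    have h1 := rlIntegral_rlIntegral_one_sub (a := 1 - α) (by linarith) (by linarith) hs.1
      (hh.mono (Icc_subset_Icc_right hs.2))
    rwa [sub_sub_cancel] at h1
  have hIc : ContinuousOn (rlIntegral α h) (Icc 0 τ) := continuousOn_rlIntegral hα0 h0.le hh
  have hgτ := hg.mono (Icc_subset_Icc_right hτ)
  have hd0 : ∀ s ∈ Icc 0 τ,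
      rlIntegral (1 - α) (fun x => (y x - y 0) - rlIntegral α h x) s = 0 := by
    intro s hs
    have hsτ : Icc 0 s ⊆ Icc 0 τ := Icc_subset_Icc_right hs.2
    rw [rlIntegral_sub (sub_pos.2 hα1) hs.1 (hgτ.mono hsτ) (hIc.mono hsτ), hJ s hs, hK s hs,
      sub_self]
  have hd : ContinuousOn (fun x => (y x - y 0) - rlIntegral α h x) (Icc 0 τ) := hgτ.sub hIc
  have hfin := eqOn_zero_of_integral_eq_zero h0 hd (fun s hs => by
    have hsτ : Icc 0 s ⊆ Icc 0 τ := Icc_subset_Icc_right hs.2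
    rw [← rlIntegral_rlIntegral_one_sub hα0 hα1 hs.1 (hd.mono hsτ),
      rlIntegral_congr (h := fun _ => (0 : E)) hs.1 (fun x hx => hd0 x (hsτ hx))]
    simp [rlIntegral]) t ht
  rw [sub_eq_zero, sub_eq_iff_eq_add] at hfin
  rw [hfin, add_comm]

theorem hasCaputoDerivOn_of_eq_add_rlIntegral {α T : ℝ} (hα0 : 0 < α) (hα1 : α < 1)
    (hT : 0 < T) {y h : ℝ → E} {ρ : E} (hh : ContinuousOn h (Icc 0 T))
    (hy : ∀ t ∈ Icc 0 T, y t = ρ + rlIntegral α h t) : HasCaputoDerivOn α T y h := by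
  have hI : ContinuousOn (rlIntegral α h) (Icc 0 T) := continuousOn_rlIntegral hα0 hT.le hh
  have hy0 : y 0 = ρ := by rw [hy 0 ⟨le_rfl, hT.le⟩, rlIntegral_zero_right, add_zero]
  refine ⟨(continuousOn_const.add hI).congr hy, fun t ht => ?_⟩
  have h1 : EqOn (rlIntegral (1 - α) (fun x => y x - y 0)) (fun t => ∫ x in (0 : ℝ)..t, h x)
      (Icc 0 T) := by
    intro s hs
    have h2 := rlIntegral_rlIntegral_one_sub (a := 1 - α) (by linarith) (by linarith) hs.1
      (hh.mono (Icc_subset_Icc_right hs.2))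
    rw [sub_sub_cancel] at h2
    simp only
    rw [← h2]
    refine rlIntegral_congr hs.1 fun x hx => ?_
    simp only [hy0, hy x ⟨hx.1, hx.2.trans hs.2⟩, add_sub_cancel_left]
  exact (hasDerivWithinAt_integral_Icc hT.le hh ht).congr h1 (h1 ht)

end Caputo

/-! ### Gronwall inequality and global solvability in exponential weights. -/

section Gronwall

variable {E : Type*} [NormedAddCommGroup E] [NormedSpace ℝ E]

theorem exists_weight {α : ℝ} (hα : 0 < α) (L : ℝ) :
    ∃ c : ℝ, 0 < c ∧ c ^ (-α) ≤ 1 ∧ L * c ^ (-α) ≤ 1 / 2 := by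
  have h1 : Tendsto (fun c : ℝ => c ^ (-α)) atTop (𝓝 0) := tendsto_rpow_neg_atTop hα
  have h2 : Tendsto (fun c : ℝ => L * c ^ (-α)) atTop (𝓝 0) := by simpa using h1.const_mul L
  obtain ⟨c, h3, h4, h5⟩ := ((eventually_gt_atTop 0).and ((h1.eventually_le_const one_pos).and
    (h2.eventually_le_const (by norm_num : (0 : ℝ) < 1 / 2)))).exists
  exact ⟨c, h3, h4, h5⟩

/-- A Gronwall inequality for the Riemann–Liouville integral. -/
theorem exists_gronwall_rlIntegral (E : Type*) [NormedAddCommGroup E] [NormedSpace ℝ E]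
    {α L : ℝ} (hα : 0 < α) (hL : 0 ≤ L) (T : ℝ) :
    ∃ C : ℝ, 0 < C ∧ ∀ τ ≤ T, ∀ (u h : ℝ → E) (a b : ℝ), 0 ≤ a → 0 ≤ b →
      ContinuousOn u (Icc 0 τ) → (∀ t ∈ Icc 0 τ, ‖u t‖ ≤ a + ‖rlIntegral α h t‖) →
      (∀ t ∈ Icc 0 τ, ‖h t‖ ≤ b + L * ‖u t‖) → ∀ t ∈ Icc 0 τ, ‖u t‖ ≤ C * (a + b) := by
  obtain ⟨c, hc, hc1, hc2⟩ := exists_weight hα L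
  -- The weighted maximum `M` of `‖u‖` will satisfy `M ≤ a + b + M / 2`, whence the factor `2`; `exp
  -- (c T)` removes the weight.
  refine ⟨2 * Real.exp (c * T), by positivity, ?_⟩
  intro τ hτ u h a b ha hb hu huh hhu t ht
  obtain ⟨t₀, ht₀, hmax⟩ := isCompact_Icc.exists_isMaxOn ⟨t, ht⟩
    ((by fun_prop : Continuous fun t : ℝ => Real.exp (-(c * t))).continuousOn.mul hu.norm)
  set M := Real.exp (-(c * t₀)) * ‖u t₀‖ with hM
  have hM0 : 0 ≤ M := by positivity
  have hle : ∀ s ∈ Icc 0 τ, ‖u s‖ ≤ M * Real.exp (c * s) := by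
    intro s hs
    have h1 : Real.exp (-(c * s)) * ‖u s‖ ≤ M := hmax hs
    calc ‖u s‖ = (Real.exp (-(c * s)) * ‖u s‖) * Real.exp (c * s) := by
          rw [mul_right_comm, ← Real.exp_add]; simp
      _ ≤ _ := mul_le_mul_of_nonneg_right h1 (Real.exp_pos _).le
  have hh : ∀ s ∈ Icc 0 t₀, ‖h s‖ ≤ (b + L * M) * Real.exp (c * s) := by
    intro s hs
    have hs' : s ∈ Icc 0 τ := ⟨hs.1, hs.2.trans ht₀.2⟩
    have h1 := hhu s hs'
    have h2 := mul_le_mul_of_nonneg_left (hle s hs') hL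
    have h3 : 1 ≤ Real.exp (c * s) := Real.one_le_exp (mul_nonneg hc.le hs.1)
    nlinarith
  have h1 := norm_rlIntegral_le_of_norm_le_exp hα hc ht₀.1 (by positivity) hh
  have hcα : 0 < c ^ (-α) := Real.rpow_pos_of_pos hc _
  have h2 : (b + L * M) * c ^ (-α) ≤ b + M / 2 := by
    have e1 := mul_le_mul_of_nonneg_left hc1 hb
    have e2 := mul_le_mul_of_nonneg_right hc2 hM0
    nlinarith
  have h3 : ‖u t₀‖ ≤ (a + b + M / 2) * Real.exp (c * t₀) := by
    have e1 := huh t₀ ht₀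
    have e2 : 1 ≤ Real.exp (c * t₀) := Real.one_le_exp (mul_nonneg hc.le ht₀.1)
    have e3 := mul_le_mul_of_nonneg_right h2 (Real.exp_pos (c * t₀)).le
    nlinarith
  have h4 : M ≤ a + b + M / 2 := by
    calc M ≤ Real.exp (-(c * t₀)) * ((a + b + M / 2) * Real.exp (c * t₀)) :=
          mul_le_mul_of_nonneg_left h3 (Real.exp_pos _).le
      _ = (a + b + M / 2) * (Real.exp (-(c * t₀)) * Real.exp (c * t₀)) := by ring
      _ = _ := by rw [← Real.exp_add]; simp
  have h5 : Real.exp (c * t) ≤ Real.exp (c * T) :=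
    Real.exp_le_exp.2 (mul_le_mul_of_nonneg_left (ht.2.trans hτ) hc.le)
  calc ‖u t‖ ≤ M * Real.exp (c * t) := hle t ht
    _ ≤ (2 * (a + b)) * Real.exp (c * T) :=
        mul_le_mul (by linarith) h5 (Real.exp_pos _).le (by linarith)
    _ = _ := by ring

/-- Global solvability of the Volterra equation `y = ρ + I^α g(·, y)` with Lipschitz `g`. -/
theorem exists_volterra_solution [CompleteSpace E] {α L T : ℝ} (hα : 0 < α) (hL : 0 ≤ L)
    (hT : 0 ≤ T) {g : ℝ → E → E} (hg : Continuous (Function.uncurry g))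
    (hgL : ∀ t u v, ‖g t u - g t v‖ ≤ L * ‖u - v‖) (ρ : E) :
    ∃ y : ℝ → E, Continuous y ∧
      ∀ t ∈ Icc 0 T, y t = ρ + rlIntegral α (fun s => g s (y s)) t := by
  obtain ⟨c, hc, -, hc2⟩ := exists_weight hα L
  -- The unknown is `v = exp (-c t) y`, so that the sup norm of `v` is the weighted norm of `y`, in
  -- which the Volterra map contracts by `L * c ^ (-α) ≤ 1 / 2`.
  let ext : C(Icc (0 : ℝ) T, E) → ℝ → E := fun v s => Real.exp (c * s) • v (projIcc 0 T hT s)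
  have hext : ∀ v, Continuous (ext v) := fun v => by fun_prop
  have hgext : ∀ v, Continuous fun s => g s (ext v s) := fun v =>
    hg.comp (continuous_id.prodMk (hext v))
  have hIc : ∀ v, ContinuousOn (rlIntegral α fun s => g s (ext v s)) (Icc 0 T) := fun v =>
    continuousOn_rlIntegral hα hT (hgext v).continuousOn
  let K : C(Icc (0 : ℝ) T, E) → C(Icc (0 : ℝ) T, E) := fun v =>
    ⟨fun t => Real.exp (-(c * t)) • (ρ + rlIntegral α (fun s => g s (ext v s)) t), by
      have := (hIc v).domRestrict
      exact (by fun_prop : Continuous fun t : Icc (0 : ℝ) T => Real.exp (-(c * t))).smul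
        (continuous_const.add this)⟩
  have hK : ContractingWith (1 / 2) K := by
    refine ⟨by norm_num, LipschitzWith.of_dist_le_mul fun v w => ?_⟩
    rw [ContinuousMap.dist_le (by positivity)]
    intro t
    have h1 : ∀ s ∈ Icc 0 (t : ℝ), ‖g s (ext v s) - g s (ext w s)‖ ≤
        (L * dist v w) * Real.exp (c * s) := by
      intro s _
      refine (hgL _ _ _).trans ?_
      simp only [ext]
      rw [← smul_sub, norm_smul, Real.norm_of_nonneg (Real.exp_pos _).le, ← dist_eq_norm]
      have := mul_le_mul_of_nonneg_left (ContinuousMap.dist_apply_le_dist (f := v) (g := w)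
        (projIcc 0 T hT s)) (mul_nonneg hL (Real.exp_pos (c * s)).le)
      linarith
    have h2 := norm_rlIntegral_le_of_norm_le_exp hα hc t.2.1 (by positivity) h1
    rw [rlIntegral_sub hα t.2.1 (hgext v).continuousOn (hgext w).continuousOn] at h2
    simp only [K, ContinuousMap.coe_mk]
    rw [dist_eq_norm, ← smul_sub, add_sub_add_left_eq_sub, norm_smul,
      Real.norm_of_nonneg (Real.exp_pos _).le]
    have h3 := mul_le_mul_of_nonneg_right hc2 (dist_nonneg (x := v) (y := w))
    calc _ ≤ Real.exp (-(c * t)) * (L * dist v w * c ^ (-α) * Real.exp (c * t)) :=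
          mul_le_mul_of_nonneg_left h2 (Real.exp_pos _).le
      _ = L * c ^ (-α) * dist v w * (Real.exp (-(c * t)) * Real.exp (c * t)) := by ring
      _ ≤ _ := by rw [← Real.exp_add]; simpa using h3
  have : Nonempty C(Icc (0 : ℝ) T, E) := ⟨0⟩
  obtain ⟨v, hv⟩ : ∃ v, K v = v := ⟨_, hK.fixedPoint_isFixedPt⟩
  refine ⟨ext v, hext v, fun t ht => ?_⟩
  have h1 : Real.exp (-(c * t)) • (ρ + rlIntegral α (fun s => g s (ext v s)) t) = v ⟨t, ht⟩ :=
    congrArg (fun w : C(Icc (0 : ℝ) T, E) => w ⟨t, ht⟩) hv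
  calc ext v t = Real.exp (c * t) • v ⟨t, ht⟩ := by simp only [ext, projIcc_of_mem hT ht]
    _ = _ := by rw [← h1, smul_smul, ← Real.exp_add]; simp

end Gronwall

/-! ### Tubes around a solution: compactness, Lipschitz bounds, linearization, truncation. -/

section Tube

variable {m : ℕ}

/-- The closed tube of radius `δ` around the graph of `y` over `[0, T]`. -/
def tube (T δ : ℝ) (y : ℝ → Fin m → ℝ) : Set (ℝ × (Fin m → ℝ)) :=
  {p | p.1 ∈ Icc 0 T ∧ ‖p.2 - y p.1‖ ≤ δ}

theorem isCompact_tube {T δ : ℝ} {y : ℝ → Fin m → ℝ} (hy : ContinuousOn y (Icc 0 T)) :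
    IsCompact (tube T δ y) := by
  have h1 : ContinuousOn (fun p : ℝ × (Fin m → ℝ) => (p.1, y p.1 + p.2))
      (Icc 0 T ×ˢ Metric.closedBall 0 δ) :=
    continuousOn_fst.prodMk
      ((hy.comp continuousOn_fst fun p hp => hp.1).add continuousOn_snd)
  have h2 : tube T δ y = (fun p : ℝ × (Fin m → ℝ) => (p.1, y p.1 + p.2)) ''
      (Icc 0 T ×ˢ Metric.closedBall 0 δ) := by
    ext ⟨t, v⟩
    simp only [tube, mem_ofPred_eq, mem_image, mem_prod, mem_closedBall_zero_iff, Prod.mk.injEq,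
      Prod.exists]
    constructor
    · rintro ⟨h1, h2⟩
      exact ⟨t, v - y t, ⟨h1, h2⟩, rfl, by abel⟩
    · rintro ⟨t, v, ⟨h1, h2⟩, rfl, rfl⟩
      exact ⟨h1, by simpa using h2⟩
  rw [h2]
  exact (isCompact_Icc.prod (isCompact_closedBall 0 δ)).image_of_continuousOn h1

theorem jacobian_mulVec (g : (Fin m → ℝ) → (Fin m → ℝ)) (v w : Fin m → ℝ) :
    jacobian g v *ᵥ w = fderiv ℝ g v w := by
  simp [jacobian, LinearMap.toMatrix'_mulVec]

theorem fderiv_eq_jacobian (g : (Fin m → ℝ) → (Fin m → ℝ)) (v : Fin m → ℝ) :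
    fderiv ℝ g v = LinearMap.toContinuousLinearMap (Matrix.toLin' (jacobian g v)) := by
  ext w : 1
  simp [jacobian_mulVec]

/-- `f` is continuously differentiable in the vector argument on some closed tube. -/
theorem ContDiffNearSolution.exists_tube {T : ℝ} {f : ℝ → (Fin m → ℝ) → (Fin m → ℝ)}
    {y : ℝ → Fin m → ℝ} (hf : ContDiffNearSolution T f y) (hy : ContinuousOn y (Icc 0 T)) :
    ∃ δ > 0, ContinuousOn (Function.uncurry f) (tube T δ y) ∧
      (∀ p ∈ tube T δ y, DifferentiableAt ℝ (f p.1) p.2) ∧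
      ContinuousOn (fun p : ℝ × (Fin m → ℝ) => fderiv ℝ (f p.1) p.2) (tube T δ y) := by
  obtain ⟨U, hU, hyU, hfc, hfd, hfj⟩ := hf
  have hK : IsCompact ((fun t => (t, y t)) '' Icc 0 T) :=
    isCompact_Icc.image_of_continuousOn (continuousOn_id.prodMk hy)
  obtain ⟨δ, hδ, hδU⟩ := hK.exists_cthickening_subset_open hU (by
    rintro _ ⟨t, ht, rfl⟩; exact hyU t ht)
  have hsub : tube T δ y ⊆ U ∩ Icc 0 T ×ˢ univ := by
    rintro ⟨t, v⟩ ⟨ht, hv⟩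
    refine ⟨hδU (Metric.mem_cthickening_of_dist_le (t, v) (t, y t) δ _ ⟨t, ht, rfl⟩ ?_), ht,
      trivial⟩
    rw [Prod.dist_eq, dist_self, dist_eq_norm]
    exact max_le hδ.le hv
  refine ⟨δ, hδ, hfc.mono hsub, fun p hp => hfd p (hsub hp), ?_⟩
  have hlin : Continuous fun A : Matrix (Fin m) (Fin m) ℝ =>
      LinearMap.toContinuousLinearMap (Matrix.toLin' A) :=
    LinearMap.continuous_of_finiteDimensional
      (((Matrix.toLin' (R := ℝ) (m := Fin m) (n := Fin m)).trans
        LinearMap.toContinuousLinearMap).toLinearMap)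
  simp only [fderiv_eq_jacobian]
  exact hlin.comp_continuousOn (hfj.mono hsub)

/-- Each time slice of the tube is a ball, hence convex, so the mean value inequality applies. -/
theorem norm_sub_le_of_fderiv_le_on_tube {T δ L : ℝ} {f : ℝ → (Fin m → ℝ) → (Fin m → ℝ)}
    {y : ℝ → Fin m → ℝ} (hd : ∀ p ∈ tube T δ y, DifferentiableAt ℝ (f p.1) p.2)
    (hL : ∀ p ∈ tube T δ y, ‖fderiv ℝ (f p.1) p.2‖ ≤ L) {t : ℝ} {u v : Fin m → ℝ}
    (hu : (t, u) ∈ tube T δ y) (hv : (t, v) ∈ tube T δ y) :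
    ‖f t u - f t v‖ ≤ L * ‖u - v‖ := by
  have hmem : ∀ w ∈ Metric.closedBall (y t) δ, (t, w) ∈ tube T δ y := fun w hw =>
    ⟨hu.1, by simpa [dist_eq_norm] using hw⟩
  have hd' : ∀ w ∈ Metric.closedBall (y t) δ, DifferentiableAt ℝ (f t) w := fun w hw =>
    hd (t, w) (hmem w hw)
  have hL' : ∀ w ∈ Metric.closedBall (y t) δ, ‖fderiv ℝ (f t) w‖ ≤ L := fun w hw =>
    hL (t, w) (hmem w hw)
  exact (convex_closedBall (y t) δ).norm_image_sub_le_of_norm_fderiv_le hd' hL'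
    (mem_closedBall_iff_norm.2 hv.2) (mem_closedBall_iff_norm.2 hu.2)

/-- Uniform differentiability along the centre of a tube. -/
theorem exists_uniform_linearization {T δ : ℝ} (hδ : 0 < δ)
    {f : ℝ → (Fin m → ℝ) → (Fin m → ℝ)} {y : ℝ → Fin m → ℝ} (hy : ContinuousOn y (Icc 0 T))
    (hd : ∀ p ∈ tube T δ y, DifferentiableAt ℝ (f p.1) p.2)
    (hc : ContinuousOn (fun p : ℝ × (Fin m → ℝ) => fderiv ℝ (f p.1) p.2) (tube T δ y))
    {ε : ℝ} (hε : 0 < ε) :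
    ∃ r > 0, ∀ t ∈ Icc 0 T, ∀ v, ‖v - y t‖ ≤ r →
      ‖f t v - f t (y t) - fderiv ℝ (f t) (y t) (v - y t)‖ ≤ ε * ‖v - y t‖ := by
  have huc := (isCompact_tube (δ := δ) hy).uniformContinuousOn_of_continuous hc
  obtain ⟨r, hr, hr'⟩ := Metric.uniformContinuousOn_iff.1 huc ε hε
  -- `δ` keeps the ball in the tube; `r / 2` secures the strict inequality of uniform continuity.
  refine ⟨min δ (r / 2), by positivity, fun t ht v hv => ?_⟩
  have hmem : ∀ w ∈ Metric.closedBall (y t) (min δ (r / 2)), (t, w) ∈ tube T δ y := fun w hw =>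
    ⟨ht, by
      rw [mem_closedBall_iff_norm] at hw
      exact hw.trans (min_le_left _ _)⟩
  have hself : y t ∈ Metric.closedBall (y t) (min δ (r / 2)) :=
    Metric.mem_closedBall_self (by positivity)
  refine (convex_closedBall (y t) (min δ (r / 2))).norm_image_sub_le_of_norm_fderiv_le' (𝕜 := ℝ)
    (fun w hw => hd _ (hmem w hw)) (fun w hw => ?_) hself (by rwa [mem_closedBall_iff_norm])
  rw [← dist_eq_norm]
  refine (hr' _ (hmem w hw) _ (hmem _ hself) ?_).le
  rw [Prod.dist_eq, dist_self]
  have h1 : dist w (y t) ≤ r / 2 := (Metric.mem_closedBall.1 hw).trans (min_le_right _ _)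
  exact max_lt hr (by linarith)

/-- The nearest point map onto the closed ball of radius `δ` for the sup norm. -/
def clamp (δ : ℝ) (v : Fin m → ℝ) : Fin m → ℝ := fun i => max (-δ) (min δ (v i))

theorem continuous_clamp (δ : ℝ) : Continuous (clamp (m := m) δ) := by
  unfold clamp; fun_prop

theorem norm_clamp_le {δ : ℝ} (hδ : 0 ≤ δ) (v : Fin m → ℝ) : ‖clamp δ v‖ ≤ δ := by
  rw [pi_norm_le_iff_of_nonneg hδ]
  intro i
  rw [Real.norm_eq_abs, abs_le]
  exact ⟨le_max_left _ _, max_le (by linarith) (min_le_left _ _)⟩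

theorem clamp_eq_self {δ : ℝ} {v : Fin m → ℝ} (hv : ‖v‖ ≤ δ) : clamp δ v = v := by
  ext i
  have h := (norm_le_pi_norm v i).trans hv
  rw [Real.norm_eq_abs, abs_le] at h
  rw [clamp, min_eq_right h.2, max_eq_right h.1]

theorem norm_clamp_sub_clamp_le (δ : ℝ) (u v : Fin m → ℝ) :
    ‖clamp δ u - clamp δ v‖ ≤ ‖u - v‖ := by
  rw [pi_norm_le_iff_of_nonneg (norm_nonneg _)]
  intro i
  refine le_trans ?_ (norm_le_pi_norm (u - v) i)
  simp only [clamp, Pi.sub_apply, Real.norm_eq_abs]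
  refine (abs_max_sub_max_le_max _ _ _ _).trans ?_
  rw [sub_self, abs_zero]
  refine max_le (abs_nonneg _) ((abs_min_sub_min_le_max _ _ _ _).trans ?_)
  rw [sub_self, abs_zero]
  exact max_le (abs_nonneg _) le_rfl

end Tube

/-! ### Unique solvability and differentiability in the initial value. -/

section InitialValueProblem

variable {m : ℕ}

theorem UniquelySolvable.isIVPSolution {α T : ℝ} {f : ℝ → (Fin m → ℝ) → (Fin m → ℝ)}
    {ρ : Fin m → ℝ} (h : UniquelySolvable α T f ρ) :
    IsIVPSolution α T f ρ (ivpSolution α T f ρ) := by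
  have h' : ∃ y, IsIVPSolution α T f ρ y := ⟨h.choose, h.choose_spec.1⟩
  rw [ivpSolution, dif_pos h']
  exact h'.choose_spec

theorem UniquelySolvable.eqOn {α T : ℝ} {f : ℝ → (Fin m → ℝ) → (Fin m → ℝ)}
    {ρ : Fin m → ℝ} (h : UniquelySolvable α T f ρ) {y z : ℝ → Fin m → ℝ}
    (hy : IsIVPSolution α T f ρ y) (hz : IsIVPSolution α T f ρ z) : EqOn y z (Icc 0 T) := by
  obtain ⟨w, -, hw⟩ := h
  exact (hw y hy).trans (hw z hz).symm

theorem continuousOn_along {T δ τ : ℝ} {f : ℝ → (Fin m → ℝ) → (Fin m → ℝ)} {y z : ℝ → Fin m → ℝ}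
    (hf : ContinuousOn (Function.uncurry f) (tube T δ y)) (hz : ContinuousOn z (Icc 0 τ))
    (hzt : ∀ t ∈ Icc 0 τ, (t, z t) ∈ tube T δ y) :
    ContinuousOn (fun t => f t (z t)) (Icc 0 τ) :=
  hf.comp (continuousOn_id.prodMk hz) hzt

theorem IsIVPSolution.eq_add_rlIntegral {α T δ τ : ℝ} (hα0 : 0 < α) (hα1 : α < 1) (hτ : τ ≤ T)
    {f : ℝ → (Fin m → ℝ) → (Fin m → ℝ)} {y z : ℝ → Fin m → ℝ} {ρ : Fin m → ℝ}
    (hf : ContinuousOn (Function.uncurry f) (tube T δ y)) (hz : IsIVPSolution α T f ρ z)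
    (hzt : ∀ t ∈ Icc 0 τ, (t, z t) ∈ tube T δ y) :
    ∀ t ∈ Icc 0 τ, z t = ρ + rlIntegral α (fun s => f s (z s)) t := by
  intro t ht
  rw [← hz.1]
  exact hz.2.eq_add_rlIntegral hα0 hα1 hτ
    (continuousOn_along hf (hz.2.1.mono (Icc_subset_Icc_right hτ)) hzt) ht

/-- Two solutions which stay in the tube up to time `τ` depend Lipschitz continuously on their
initial values. -/
theorem exists_lipschitz_in_tube {α T δ L : ℝ} (hα0 : 0 < α) (hα1 : α < 1) (hL : 0 ≤ L)
    {f : ℝ → (Fin m → ℝ) → (Fin m → ℝ)} {y : ℝ → Fin m → ℝ}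
    (hf : ContinuousOn (Function.uncurry f) (tube T δ y))
    (hfL : ∀ t u v, (t, u) ∈ tube T δ y → (t, v) ∈ tube T δ y →
      ‖f t u - f t v‖ ≤ L * ‖u - v‖) :
    ∃ C > 0, ∀ τ ≤ T, ∀ (ρ ρ' : Fin m → ℝ) (z w : ℝ → Fin m → ℝ),
      IsIVPSolution α T f ρ z → IsIVPSolution α T f ρ' w →
      (∀ t ∈ Icc 0 τ, (t, z t) ∈ tube T δ y) → (∀ t ∈ Icc 0 τ, (t, w t) ∈ tube T δ y) →
      ∀ t ∈ Icc 0 τ, ‖z t - w t‖ ≤ C * ‖ρ - ρ'‖ := by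
  obtain ⟨C, hC, hG⟩ := exists_gronwall_rlIntegral (Fin m → ℝ) hα0 hL T
  refine ⟨C, hC, fun τ hτ ρ ρ' z w hz hw hzt hwt t ht => ?_⟩
  have hzc := hz.2.1.mono (Icc_subset_Icc_right hτ)
  have hwc := hw.2.1.mono (Icc_subset_Icc_right hτ)
  have h := hG τ hτ (fun t => z t - w t) (fun s => f s (z s) - f s (w s)) ‖ρ - ρ'‖ 0
    (norm_nonneg _) le_rfl (hzc.sub hwc) ?_ ?_ t ht
  · simpa using h
  · intro s hs
    have hsτ : Icc 0 s ⊆ Icc 0 τ := Icc_subset_Icc_right hs.2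
    rw [hz.eq_add_rlIntegral hα0 hα1 hτ hf hzt s hs, hw.eq_add_rlIntegral hα0 hα1 hτ hf hwt s hs,
      rlIntegral_sub hα0 hs.1 ((continuousOn_along hf hzc hzt).mono hsτ)
        ((continuousOn_along hf hwc hwt).mono hsτ), add_sub_add_comm]
    exact norm_add_le _ _
  · intro s hs
    rw [zero_add]
    exact hfL s _ _ (hzt s hs) (hwt s hs)

/-- Existence of a solution in the tube, by truncation of the right-hand side. -/
theorem exists_solution_in_tube {α T δ L : ℝ} (hα0 : 0 < α) (hα1 : α < 1) (hT : 0 < T)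
    (hδ : 0 < δ) (hL : 0 ≤ L) {f : ℝ → (Fin m → ℝ) → (Fin m → ℝ)} {y : ℝ → Fin m → ℝ}
    {ρ₀ : Fin m → ℝ} (hf : ContinuousOn (Function.uncurry f) (tube T δ y))
    (hfL : ∀ t u v, (t, u) ∈ tube T δ y → (t, v) ∈ tube T δ y →
      ‖f t u - f t v‖ ≤ L * ‖u - v‖) (hy : IsIVPSolution α T f ρ₀ y) :
    ∃ r > 0, ∀ ρ, ‖ρ - ρ₀‖ < r → ∃ z, IsIVPSolution α T f ρ z := by
  obtain ⟨C, hC, hG⟩ := exists_gronwall_rlIntegral (Fin m → ℝ) hα0 hL T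
  -- With this radius Gronwall keeps the truncated solution within `δ` of `y`, where the truncation
  -- is inactive.
  refine ⟨δ / C, by positivity, fun ρ hρ => ?_⟩
  let P : ℝ → ℝ := fun t => projIcc 0 T hT.le t
  have hPc : Continuous P := by fun_prop
  have hPm : ∀ t, P t ∈ Icc 0 T := fun t => (projIcc 0 T hT.le t).2
  have hP : ∀ t ∈ Icc 0 T, P t = t := fun t ht => by simp only [P, projIcc_of_mem hT.le ht]
  have hyP : Continuous fun t => y (P t) := hy.2.1.comp_continuous hPc hPm
  let g : ℝ → (Fin m → ℝ) → (Fin m → ℝ) := fun t v => f (P t) (y (P t) + clamp δ (v - y (P t)))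
  have hmem : ∀ t v, (P t, y (P t) + clamp δ (v - y (P t))) ∈ tube T δ y := fun t v =>
    ⟨hPm t, by simpa using norm_clamp_le hδ.le _⟩
  have hg : Continuous (Function.uncurry g) := by
    refine hf.comp_continuous (f := fun p : ℝ × (Fin m → ℝ) =>
      (P p.1, y (P p.1) + clamp δ (p.2 - y (P p.1)))) ?_ fun p => hmem p.1 p.2
    have := hyP.comp (continuous_fst (X := ℝ) (Y := Fin m → ℝ))
    exact (hPc.comp continuous_fst).prodMk
      (this.add ((continuous_clamp δ).comp (continuous_snd.sub this)))
  have hgL : ∀ t u v, ‖g t u - g t v‖ ≤ L * ‖u - v‖ := fun t u v => by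
    refine (hfL _ _ _ (hmem t u) (hmem t v)).trans (mul_le_mul_of_nonneg_left ?_ hL)
    rw [add_sub_add_left_eq_sub]
    exact (norm_clamp_sub_clamp_le _ _ _).trans_eq (by rw [sub_sub_sub_cancel_right])
  have hgf : ∀ t ∈ Icc 0 T, ∀ v, ‖v - y t‖ ≤ δ → g t v = f t v := fun t ht v hv => by
    simp only [g, hP t ht, clamp_eq_self hv, add_sub_cancel]
  have hyt : ∀ t ∈ Icc 0 T, (t, y t) ∈ tube T δ y := fun t ht => ⟨ht, by simpa using hδ.le⟩
  obtain ⟨z, hzc, hz⟩ := exists_volterra_solution hα0 hL hT.le hg hgL ρ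
  have hgz : Continuous fun s => g s (z s) := hg.comp (continuous_id.prodMk hzc)
  have hgy : ContinuousOn (fun s => g s (y s)) (Icc 0 T) :=
    hg.comp_continuousOn (continuousOn_id.prodMk hy.2.1)
  have hclose : ∀ t ∈ Icc 0 T, ‖z t - y t‖ ≤ δ := by
    intro t ht
    have h := hG T le_rfl (fun t => z t - y t) (fun s => g s (z s) - g s (y s)) ‖ρ - ρ₀‖ 0
      (norm_nonneg _) le_rfl (hzc.continuousOn.sub hy.2.1) ?_ ?_ t ht
    · rw [add_zero] at h
      rw [lt_div_iff₀ hC] at hρ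
      linarith
    · intro s hs
      have hsT : Icc 0 s ⊆ Icc 0 T := Icc_subset_Icc_right hs.2
      rw [hz s hs, hy.eq_add_rlIntegral hα0 hα1 le_rfl hf hyt s hs,
        rlIntegral_sub hα0 hs.1 hgz.continuousOn (hgy.mono hsT), add_sub_add_comm,
        rlIntegral_congr (g := fun s => g s (y s)) (h := fun s => f s (y s)) hs.1
          fun x hx => hgf x (hsT hx) _ (by simpa using hδ.le)]
      exact norm_add_le _ _
    · intro s _
      rw [zero_add]
      exact hgL s _ _
  have hz' : ∀ t ∈ Icc 0 T, z t = ρ + rlIntegral α (fun s => f s (z s)) t := by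
    intro t ht
    have htT : Icc 0 t ⊆ Icc 0 T := Icc_subset_Icc_right ht.2
    rw [← rlIntegral_congr (g := fun s => g s (z s)) ht.1
      fun x hx => hgf x (htT hx) _ (hclose x (htT hx))]
    exact hz t ht
  refine ⟨z, by simpa [rlIntegral_zero_right] using hz' 0 ⟨le_rfl, hT.le⟩,
    hasCaputoDerivOn_of_eq_add_rlIntegral hα0 hα1 hT ?_ hz'⟩
  exact continuousOn_along hf hzc.continuousOn fun t ht => ⟨ht, hclose t ht⟩

/-- Near the initial value of a solution `y` the initial value problem is uniquely solvable, and
the solutions depend Lipschitz continuously on the initial value at `y`. -/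
theorem exists_uniquelySolvable_near {α T δ L : ℝ} (hα0 : 0 < α) (hα1 : α < 1) (hT : 0 < T)
    (hδ : 0 < δ) (hL : 0 ≤ L) {f : ℝ → (Fin m → ℝ) → (Fin m → ℝ)} {y : ℝ → Fin m → ℝ}
    {ρ₀ : Fin m → ℝ} (hf : ContinuousOn (Function.uncurry f) (tube T δ y))
    (hfL : ∀ t u v, (t, u) ∈ tube T δ y → (t, v) ∈ tube T δ y →
      ‖f t u - f t v‖ ≤ L * ‖u - v‖) (hy : IsIVPSolution α T f ρ₀ y) :
    ∃ r > 0, ∃ C > 0, ∀ ρ, ‖ρ - ρ₀‖ < r → UniquelySolvable α T f ρ ∧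
      ∀ z, IsIVPSolution α T f ρ z → ∀ t ∈ Icc 0 T,
        (t, z t) ∈ tube T δ y ∧ ‖z t - y t‖ ≤ C * ‖ρ - ρ₀‖ := by
  obtain ⟨C, hC, hlip⟩ := exists_lipschitz_in_tube hα0 hα1 hL hf hfL
  obtain ⟨r, hr, hex⟩ := exists_solution_in_tube hα0 hα1 hT hδ hL hf hfL hy
  have hyt : ∀ t ∈ Icc 0 T, (t, y t) ∈ tube T δ y := fun t ht => ⟨ht, by simpa using hδ.le⟩
  -- `r` gives existence, `δ` a start strictly inside the tube, and `δ / C` a contradiction at the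
  -- exit time.
  refine ⟨min r (min δ (δ / C)), by positivity, C, hC, fun ρ hρ => ?_⟩
  obtain ⟨hρr, hρδ, hρC⟩ : ‖ρ - ρ₀‖ < r ∧ ‖ρ - ρ₀‖ < δ ∧ ‖ρ - ρ₀‖ < δ / C := by
    simpa only [lt_min_iff] using hρ
  rw [lt_div_iff₀ hC] at hρC
  have htube : ∀ z, IsIVPSolution α T f ρ z → ∀ t ∈ Icc 0 T, (t, z t) ∈ tube T δ y := by
    intro z hz
    by_contra! hcon
    obtain ⟨t₁, ht₁, hzt₁⟩ := hcon
    have hφ : ContinuousOn (fun t => ‖z t - y t‖) (Icc 0 T) := (hz.2.1.sub hy.2.1).norm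
    have hS : IsCompact (Icc 0 T ∩ (fun t => ‖z t - y t‖) ⁻¹' Ici δ) :=
      isCompact_Icc.of_isClosed_subset (hφ.preimage_isClosed_of_isClosed isClosed_Icc isClosed_Ici)
        inter_subset_left
    -- `τ` is the first time at distance at least `δ`; up to `τ` the solution is in the closed tube,
    -- so the Lipschitz estimate gives a distance below `δ` at `τ`.
    obtain ⟨τ, ⟨hτ, hτδ⟩, hmin⟩ := hS.exists_isLeast
      ⟨t₁, ht₁, (not_le.1 fun h => hzt₁ ⟨ht₁, h⟩).le⟩
    have hlt : ∀ t ∈ Ico 0 τ, ‖z t - y t‖ ≤ δ := fun t ht => by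
      by_contra! h
      exact (hmin ⟨⟨ht.1, ht.2.le.trans hτ.2⟩, h.le⟩).not_gt ht.2
    have hτ0 : 0 < τ := by
      refine hτ.1.lt_of_ne' ?_
      rintro rfl
      have : δ ≤ ‖z 0 - y 0‖ := hτδ
      rw [hz.1, hy.1] at this
      linarith
    have hτle : ‖z τ - y τ‖ ≤ δ := by
      refine ContinuousWithinAt.closure_le (s := Ico 0 τ) (x := τ)
        (f := fun t => ‖z t - y t‖) (g := fun _ => δ) ?_ ?_ continuousWithinAt_const hlt
      · rw [closure_Ico hτ0.ne]; exact ⟨hτ0.le, le_rfl⟩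
      · exact (hφ τ hτ).mono fun t ht => ⟨ht.1, ht.2.le.trans hτ.2⟩
    have hzt : ∀ t ∈ Icc 0 τ, (t, z t) ∈ tube T δ y := fun t ht => by
      refine ⟨⟨ht.1, ht.2.trans hτ.2⟩, ?_⟩
      rcases ht.2.lt_or_eq with h | rfl
      · exact hlt t ⟨ht.1, h⟩
      · exact hτle
    have h := hlip τ hτ.2 ρ ρ₀ z y hz hy hzt
      (fun t ht => hyt t ⟨ht.1, ht.2.trans hτ.2⟩) τ ⟨hτ.1, le_rfl⟩
    have h' : δ ≤ ‖z τ - y τ‖ := hτδ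
    linarith
  obtain ⟨z, hz⟩ := hex ρ hρr
  refine ⟨⟨z, hz, fun w hw t ht => ?_⟩, fun z hz t ht => ⟨htube z hz t ht, ?_⟩⟩
  · have h := hlip T le_rfl ρ ρ w z hw hz (htube w hw) (htube z hz) t ht
    rw [sub_self, norm_zero, mul_zero] at h
    exact sub_eq_zero.1 (norm_le_zero_iff.1 h)
  · exact hlip T le_rfl ρ ρ₀ z y hz hy (htube z hz) hyt t ht

theorem exists_fderiv_bound_on_tube {T δ : ℝ} {f : ℝ → (Fin m → ℝ) → (Fin m → ℝ)}
    {y : ℝ → Fin m → ℝ} (hy : ContinuousOn y (Icc 0 T))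
    (hc : ContinuousOn (fun p : ℝ × (Fin m → ℝ) => fderiv ℝ (f p.1) p.2) (tube T δ y)) :
    ∃ L ≥ 0, ∀ p ∈ tube T δ y, ‖fderiv ℝ (f p.1) p.2‖ ≤ L := by
  obtain ⟨L, hL⟩ := (isCompact_tube (δ := δ) hy).exists_bound_of_continuousOn hc
  exact ⟨max L 0, le_max_right _ _, fun p hp => (hL p hp).trans (le_max_left _ _)⟩

theorem eventually_uniquelySolvable {α T : ℝ} (hα0 : 0 < α) (hα1 : α < 1) (hT : 0 < T)
    {f : ℝ → (Fin m → ℝ) → (Fin m → ℝ)} {y : ℝ → Fin m → ℝ} {ρ₀ : Fin m → ℝ}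
    (hy : IsIVPSolution α T f ρ₀ y) (hf : ContDiffNearSolution T f y) :
    ∀ᶠ ρ in 𝓝 ρ₀, UniquelySolvable α T f ρ := by
  obtain ⟨δ, hδ, hfc, hfd, hfj⟩ := hf.exists_tube hy.2.1
  obtain ⟨L, hL0, hL⟩ := exists_fderiv_bound_on_tube hy.2.1 hfj
  obtain ⟨r, hr, C, -, hsolv⟩ := exists_uniquelySolvable_near hα0 hα1 hT hδ hL0 hfc
    (fun t u v hu hv => norm_sub_le_of_fderiv_le_on_tube hfd hL hu hv) hy
  filter_upwards [Metric.ball_mem_nhds ρ₀ hr] with ρ hρ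
  exact (hsolv ρ (mem_ball_iff_norm.1 hρ)).1

/-- The entrywise equations are combined by the functional `w ↦ ∑ j, w j * v j` on each row, which
commutes with the integral. -/
theorem IsFundamentalMatrix.mulVec_eq_add_rlIntegral {α T : ℝ} (hα0 : 0 < α) (hα1 : α < 1)
    {A Φ : ℝ → Matrix (Fin m) (Fin m) ℝ} (hA : ∀ i j, ContinuousOn (fun t => A t i j) (Icc 0 T))
    (hΦ : IsFundamentalMatrix α T A Φ) (v : Fin m → ℝ) :
    ContinuousOn (fun t => A t *ᵥ (Φ t *ᵥ v)) (Icc 0 T) ∧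
    ∀ t ∈ Icc 0 T, Φ t *ᵥ v = v + rlIntegral α (fun s => A s *ᵥ (Φ s *ᵥ v)) t := by
  have hAΦ : ∀ i j, ContinuousOn (fun t => (A t * Φ t) i j) (Icc 0 T) := fun i j => by
    simp only [Matrix.mul_apply]
    exact continuousOn_finsetSum _ fun k _ => (hA i k).mul (hΦ.2 k j).1
  have hrow : ∀ i, ContinuousOn (fun t j => (A t * Φ t) i j) (Icc 0 T) := fun i =>
    continuousOn_pi.2 fun j => hAΦ i j
  let D : (Fin m → ℝ) →L[ℝ] ℝ := ∑ j, v j • ContinuousLinearMap.proj (R := ℝ) j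
  have hD : ∀ w, D w = ∑ j, w j * v j := fun w => by
    simp [D, mul_comm]
  have hDrow : ∀ t i, (A t *ᵥ (Φ t *ᵥ v)) i = D fun j => (A t * Φ t) i j := fun t i => by
    rw [Matrix.mulVec_mulVec, hD]; rfl
  have hcont : ContinuousOn (fun t => A t *ᵥ (Φ t *ᵥ v)) (Icc 0 T) := by
    refine continuousOn_pi.2 fun i => ?_
    simp only [hDrow]
    exact D.continuous.comp_continuousOn (hrow i)
  refine ⟨hcont, fun t ht => ?_⟩
  have htT : Icc 0 t ⊆ Icc 0 T := Icc_subset_Icc_right ht.2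
  ext i
  have h1 : rlIntegral α (fun s => A s *ᵥ (Φ s *ᵥ v)) t i =
      D (rlIntegral α (fun s j => (A s * Φ s) i j) t) := by
    rw [← rlIntegral_clm_comp hα0 ht.1 ((hrow i).mono htT) D]
    simp only [← hDrow]
    exact (rlIntegral_clm_comp hα0 ht.1 (hcont.mono htT)
      (ContinuousLinearMap.proj (R := ℝ) (φ := fun _ : Fin m => ℝ) i)).symm
  have h2 : ∀ j, rlIntegral α (fun s j => (A s * Φ s) i j) t j =
      Φ t i j - (1 : Matrix (Fin m) (Fin m) ℝ) i j := fun j => by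
    have h3 := (hΦ.2 i j).eq_add_rlIntegral hα0 hα1 le_rfl (hAΦ i j) ht
    rw [hΦ.1] at h3
    rw [h3, add_sub_cancel_left]
    exact (rlIntegral_clm_comp hα0 ht.1 ((hrow i).mono htT)
      (ContinuousLinearMap.proj (R := ℝ) (φ := fun _ : Fin m => ℝ) j)).symm
  have h4 : ∑ j, (1 : Matrix (Fin m) (Fin m) ℝ) i j * v j = v i := by
    have := congrFun (Matrix.one_mulVec v) i
    simpa [Matrix.mulVec, dotProduct] using this
  rw [Pi.add_apply, h1, hD]
  simp only [h2, sub_mul, Finset.sum_sub_distrib, h4]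
  simp [Matrix.mulVec, dotProduct]

/-- The terminal value is differentiable in the initial value, with derivative the fundamental
matrix of the linearized problem. -/
theorem hasFDerivAt_terminal_value {α T : ℝ} (hα0 : 0 < α) (hα1 : α < 1) (hT : 0 < T)
    {f : ℝ → (Fin m → ℝ) → (Fin m → ℝ)} {y : ℝ → Fin m → ℝ} {ρ₀ : Fin m → ℝ}
    (hy : IsIVPSolution α T f ρ₀ y) (hf : ContDiffNearSolution T f y)
    {Φ : ℝ → Matrix (Fin m) (Fin m) ℝ}
    (hΦ : IsFundamentalMatrix α T (fun t => jacobian (f t) (ivpSolution α T f ρ₀ t)) Φ) :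
    HasFDerivAt (fun ρ => ivpSolution α T f ρ T)
      (LinearMap.toContinuousLinearMap (Matrix.toLin' (Φ T))) ρ₀ := by
  obtain ⟨δ, hδ, hfc, hfd, hfj⟩ := hf.exists_tube hy.2.1
  obtain ⟨L, hL0, hL⟩ := exists_fderiv_bound_on_tube hy.2.1 hfj
  obtain ⟨r, hr, C, hC, hsolv⟩ := exists_uniquelySolvable_near hα0 hα1 hT hδ hL0 hfc
    (fun t u v hu hv => norm_sub_le_of_fderiv_le_on_tube hfd hL hu hv) hy
  obtain ⟨C', hC', hG⟩ := exists_gronwall_rlIntegral (Fin m → ℝ) hα0 hL0 T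
  have hyt : ∀ t ∈ Icc 0 T, (t, y t) ∈ tube T δ y := fun t ht => ⟨ht, by simpa using hδ.le⟩
  -- The variational problem is linearized along the chosen `ivpSolution`; uniqueness identifies it
  -- with `y` on `[0, T]`.
  have h₀ : EqOn (ivpSolution α T f ρ₀) y (Icc 0 T) := by
    have h := (hsolv ρ₀ (by simpa using hr)).1
    exact h.eqOn h.isIVPSolution hy
  have hA : ∀ i j, ContinuousOn
      (fun t => jacobian (f t) (ivpSolution α T f ρ₀ t) i j) (Icc 0 T) := by
    intro i j
    have h1 : ContinuousOn (fun t => fderiv ℝ (f t) (y t)) (Icc 0 T) :=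
      hfj.comp (f := fun t => (t, y t)) (continuousOn_id.prodMk hy.2.1) hyt
    have h2 : ContinuousOn (fun t => fderiv ℝ (f t) (y t) (Pi.single j 1) i) (Icc 0 T) :=
      (continuous_apply i).comp_continuousOn (h1.clm_apply continuousOn_const)
    refine h2.congr fun t ht => ?_
    simp only [h₀ ht, ← jacobian_mulVec, Matrix.mulVec_single_one, Matrix.col_apply]
  refine HasFDerivAt.of_isLittleO (Asymptotics.isLittleO_iff.2 fun ε hε => ?_)
  -- `C` bounds `‖z - y‖` by `C * ‖ρ - ρ₀‖` and `C'` is the Gronwall constant, so the final error is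
  -- exactly `ε * ‖ρ - ρ₀‖`.
  obtain ⟨r', hr', hlin⟩ := exists_uniform_linearization hδ hy.2.1 hfd hfj
    (ε := ε / (C' * C)) (by positivity)
  have hnear : ∀ᶠ ρ in 𝓝 ρ₀, ‖ρ - ρ₀‖ < min r (r' / C) := by
    have := Metric.ball_mem_nhds ρ₀ (ε := min r (r' / C)) (by positivity)
    filter_upwards [this] with ρ hρ
    rwa [mem_ball_iff_norm] at hρ
  filter_upwards [hnear] with ρ hρ
  obtain ⟨hρr, hρr'⟩ := lt_min_iff.1 hρ
  rw [lt_div_iff₀ hC] at hρr'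
  obtain ⟨huniq, hz⟩ := hsolv ρ hρr
  have hzs := huniq.isIVPSolution
  set z := ivpSolution α T f ρ with hzdef
  have hz := hz z hzs
  obtain ⟨hΦc, hΦv⟩ := hΦ.mulVec_eq_add_rlIntegral hα0 hα1 hA (ρ - ρ₀)
  have hTmem : T ∈ Icc 0 T := ⟨hT.le, le_rfl⟩
  have hzt : ∀ t ∈ Icc 0 T, (t, z t) ∈ tube T δ y := fun t ht => (hz t ht).1
  have hfz := continuousOn_along hfc hzs.2.1 hzt
  have hfy := continuousOn_along hfc hy.2.1 hyt
  have hfzy : ContinuousOn (fun t => f t (z t) - f t (y t)) (Icc 0 T) := hfz.sub hfy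
  have hw : ∀ t ∈ Icc 0 T, z t - y t - Φ t *ᵥ (ρ - ρ₀) = rlIntegral α (fun s =>
      f s (z s) - f s (y s) - jacobian (f s) (ivpSolution α T f ρ₀ s) *ᵥ (Φ s *ᵥ (ρ - ρ₀))) t := by
    intro t ht
    have htT : Icc 0 t ⊆ Icc 0 T := Icc_subset_Icc_right ht.2
    rw [rlIntegral_sub hα0 ht.1 (hfzy.mono htT) (hΦc.mono htT),
      rlIntegral_sub hα0 ht.1 (hfz.mono htT) (hfy.mono htT), hΦv t ht,
      hzs.eq_add_rlIntegral hα0 hα1 le_rfl hfc hzt t ht,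
      hy.eq_add_rlIntegral hα0 hα1 le_rfl hfc hyt t ht]
    abel
  have hΦcont : ContinuousOn (fun t => Φ t *ᵥ (ρ - ρ₀)) (Icc 0 T) := by
    refine continuousOn_pi.2 fun i => ?_
    simp only [Matrix.mulVec, dotProduct]
    exact continuousOn_finsetSum _ fun j _ => (hΦ.2 i j).1.mul continuousOn_const
  have hfin := hG T le_rfl (fun t => z t - y t - Φ t *ᵥ (ρ - ρ₀)) _ 0
    (ε / (C' * C) * (C * ‖ρ - ρ₀‖)) le_rfl (by positivity) ((hzs.2.1.sub hy.2.1).sub hΦcont)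
    (fun t ht => by rw [zero_add, ← hw t ht]) ?_ T hTmem
  · have e : C' * (0 + ε / (C' * C) * (C * ‖ρ - ρ₀‖)) = ε * ‖ρ - ρ₀‖ := by
      field_simp; ring
    rw [e] at hfin
    simpa [h₀ hTmem] using hfin
  · intro s hs
    -- The integrand splits into the Taylor remainder of `f`, which is the small forcing, and the
    -- linearization applied to the error itself, which Gronwall absorbs.
    have e1 : f s (z s) - f s (y s) - jacobian (f s) (ivpSolution α T f ρ₀ s) *ᵥ (Φ s *ᵥ (ρ - ρ₀))
        = (f s (z s) - f s (y s) - fderiv ℝ (f s) (y s) (z s - y s)) +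
          fderiv ℝ (f s) (y s) (z s - y s - Φ s *ᵥ (ρ - ρ₀)) := by
      rw [h₀ hs, jacobian_mulVec, map_sub _ (z s - y s)]
      abel
    rw [e1]
    refine (norm_add_le _ _).trans (add_le_add ?_ ?_)
    · refine (hlin s hs _ ?_).trans ?_
      · exact (hz s hs).2.trans (by linarith)
      · exact mul_le_mul_of_nonneg_left (hz s hs).2 (by positivity)
    · exact (ContinuousLinearMap.le_opNorm _ _).trans
        (mul_le_mul_of_nonneg_right (hL (s, y s) (hyt s hs)) (norm_nonneg _))

end InitialValueProblem

/-! ### Ostrowski's theorem on attracting fixed points. -/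

section Ostrowski

/-- A fixed point at which some power of the derivative is a contraction attracts all nearby
points. -/
theorem eventually_iterate_tendsto_of_norm_pow_lt_one {E : Type*} [NormedAddCommGroup E]
    [NormedSpace ℝ E] {G : E → E} {x₀ : E} {A : E →L[ℝ] E} (hG : HasFDerivAt G A x₀)
    (hfix : G x₀ = x₀) {k : ℕ} (hk : 0 < k) (hA : ‖A ^ k‖ < 1) {P : E → Prop}
    (hP : ∀ᶠ x in 𝓝 x₀, P x) :
    ∀ᶠ x in 𝓝 x₀, (∀ l, P (G^[l] x)) ∧ Tendsto (fun l => G^[l] x) atTop (𝓝 x₀) := by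
  -- Only `G^[k]` contracts; continuity of the iterates `j < k` at the fixed point controls the
  -- steps in between.
  have hit : ∀ {Q : E → Prop}, (∀ᶠ x in 𝓝 x₀, Q x) → ∀ᶠ x in 𝓝 x₀, ∀ j < k, Q (G^[j] x) := by
    intro Q hQ
    refine (eventually_all_finite (Set.finite_lt_nat k)).2 fun j _ => ?_
    have h1 : Tendsto (G^[j]) (𝓝 x₀) (𝓝 x₀) := by
      have := (hG.iterate hfix j).continuousAt
      rwa [ContinuousAt, Function.iterate_fixed hfix] at this
    exact h1.eventually hQ
  obtain ⟨q, hAq, hq⟩ := exists_between hA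
  have hq0 : 0 ≤ q := (norm_nonneg _).trans hAq.le
  have hH : ∀ᶠ x in 𝓝 x₀, ‖G^[k] x - x₀‖ ≤ q * ‖x - x₀‖ := by
    have h1 := (hG.iterate hfix k).isLittleO
    -- The gap `q - ‖A ^ k‖` is spent on the differentiability remainder.
    have h2 := Asymptotics.isLittleO_iff.1 h1 (sub_pos.2 hAq)
    filter_upwards [h2] with x hx
    rw [Function.iterate_fixed hfix] at hx
    have h3 := (A ^ k).le_opNorm (x - x₀)
    have h4 := norm_add_le (G^[k] x - x₀ - (A ^ k) (x - x₀)) ((A ^ k) (x - x₀))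
    rw [sub_add_cancel] at h4
    linarith
  obtain ⟨r, hr, hball⟩ := Metric.eventually_nhds_iff_ball.1 (hH.and (hit hP))
  filter_upwards [Metric.ball_mem_nhds x₀ hr] with x hx
  have hn : ∀ n, ‖(G^[k])^[n] x - x₀‖ ≤ q ^ n * ‖x - x₀‖ := by
    intro n
    induction n with
    | zero => simp
    | succ n ih =>
      have hmem : (G^[k])^[n] x ∈ Metric.ball x₀ r := by
        rw [mem_ball_iff_norm] at hx ⊢
        refine lt_of_le_of_lt (ih.trans ?_) hx
        exact mul_le_of_le_one_left (norm_nonneg _) (pow_le_one₀ hq0 hq.le)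
      rw [Function.iterate_succ_apply', pow_succ']
      refine (hball _ hmem).1.trans ?_
      rw [mul_assoc]
      exact mul_le_mul_of_nonneg_left ih hq0
  have hsplit : ∀ l, G^[l] x = G^[l % k] ((G^[k])^[l / k] x) := fun l => by
    rw [← Function.iterate_mul, ← Function.iterate_add_apply, Nat.mod_add_div]
  refine ⟨fun l => ?_, ?_⟩
  · rw [hsplit]
    refine (hball _ ?_).2 _ (Nat.mod_lt _ hk)
    rw [mem_ball_iff_norm] at hx ⊢
    exact lt_of_le_of_lt ((hn _).trans (mul_le_of_le_one_left (norm_nonneg _)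
      (pow_le_one₀ hq0 hq.le))) hx
  · have h1 : Tendsto (fun n => (G^[k])^[n] x) atTop (𝓝 x₀) := by
      rw [tendsto_iff_norm_sub_tendsto_zero]
      refine squeeze_zero (fun _ => norm_nonneg _) hn ?_
      simpa using (tendsto_pow_atTop_nhds_zero_of_lt_one hq0 hq).mul_const ‖x - x₀‖
    have h2 : Tendsto (fun l => (G^[k])^[l / k] x) atTop (𝓝 x₀) :=
      h1.comp (Nat.tendsto_div_const_atTop hk.ne')
    intro V hV
    have h3 := h2.eventually (hit (Q := fun z => z ∈ V) hV)
    rw [mem_map]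
    filter_upwards [h3] with l hl
    rw [mem_preimage, hsplit]
    exact hl _ (Nat.mod_lt _ hk)

end Ostrowski

/-! ### From spectral radius to a contracting power. -/

section SpectralRadius

open scoped Matrix.Norms.Operator

variable {m : ℕ}

/-- The maximal row sum does not see complexification, so Gelfand's formula over `ℂ` bounds powers
of the real matrix. -/
theorem norm_map_algebraMap_complex (A : Matrix (Fin m) (Fin m) ℝ) :
    ‖A.map (algebraMap ℝ ℂ)‖₊ = ‖A‖₊ := by
  simp [Matrix.linfty_opNNNorm_def]

/-- A power of a real matrix of spectral radius less than one is a contraction for the sup norm. -/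
theorem exists_norm_pow_lt_one_of_realMatrixSpectralRadius_lt_one
    {A : Matrix (Fin m) (Fin m) ℝ} (hA : realMatrixSpectralRadius A < 1) :
    ∃ k > 0, ‖(LinearMap.toContinuousLinearMap (Matrix.toLin' A)) ^ k‖ < 1 := by
  have h1 := spectrum.pow_nnnorm_pow_one_div_tendsto_nhds_spectralRadius (A.map (algebraMap ℝ ℂ))
  obtain ⟨k, hk, hk0⟩ := ((h1.eventually_lt_const hA).and (eventually_gt_atTop 0)).exists
  have h2 : A.map (algebraMap ℝ ℂ) ^ k = (A ^ k).map (algebraMap ℝ ℂ) :=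
    ((algebraMap ℝ ℂ).mapMatrix.map_pow A k).symm
  rw [h2, norm_map_algebraMap_complex] at hk
  have h3 : ‖A ^ k‖₊ < 1 := by
    by_contra! h
    refine hk.not_ge (ENNReal.one_le_rpow ?_ (by positivity))
    exact_mod_cast h
  have h4 : ∀ v, ((LinearMap.toContinuousLinearMap (Matrix.toLin' A)) ^ k) v = (A ^ k) *ᵥ v := by
    intro v
    have := congrArg (fun f : (Fin m → ℝ) →ₗ[ℝ] (Fin m → ℝ) => f v) (Matrix.toLin'_pow A k)
    simp only [Matrix.toLin'_apply] at this
    rw [this, FunLike.coe_pow_eq_iterate, Module.End.pow_apply]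
    rfl
  refine ⟨k, hk0, lt_of_le_of_lt (ContinuousLinearMap.opNorm_le_bound _ (norm_nonneg (A ^ k))
    fun v => ?_) h3⟩
  rw [h4]
  exact Matrix.linfty_opNorm_mulVec _ _

end SpectralRadius

/-! ### The simplified Newton map and its derivative. -/

section SimplifiedNewton

variable {m : ℕ}

/-- The derivative of the simplified Newton map at a zero of `F`. -/
theorem hasFDerivAt_sub_mulVec {F : (Fin m → ℝ) → (Fin m → ℝ)}
    {B : (Fin m → ℝ) → Matrix (Fin m) (Fin m) ℝ} {x₀ : Fin m → ℝ}
    {M : Matrix (Fin m) (Fin m) ℝ}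
    (hF : HasFDerivAt F (LinearMap.toContinuousLinearMap (Matrix.toLin' M)) x₀) (hF0 : F x₀ = 0)
    (hB : ContinuousAt B x₀) :
    HasFDerivAt (fun x => x - B x *ᵥ F x)
      (LinearMap.toContinuousLinearMap (Matrix.toLin' (1 - B x₀ * M))) x₀ := by
  -- Freezing `B` at `x₀` costs `o(1) * O(x - x₀)`, because `F x₀ = 0`; mere continuity of `B`
  -- suffices.
  have h1 : (fun x => B x *ᵥ F x - B x₀ *ᵥ F x) =o[𝓝 x₀] fun x => x - x₀ := by
    have e1 : F =O[𝓝 x₀] fun x => x - x₀ := by simpa [hF0] using hF.isBigO_sub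
    refine Asymptotics.isLittleO_pi.2 fun i => ?_
    simp only [← Matrix.sub_mulVec, Matrix.mulVec, dotProduct]
    refine Asymptotics.IsLittleO.fun_sum fun j _ => ?_
    have e2 : (fun x => (B x - B x₀) i j) =o[𝓝 x₀] fun _ => (1 : ℝ) := by
      rw [Asymptotics.isLittleO_one_iff]
      have : ContinuousAt (fun x => B x i j) x₀ :=
        (continuous_apply_apply i j).continuousAt.comp hB
      simpa using this.tendsto.sub_const (B x₀ i j)
    have e3 : (fun x => F x j) =O[𝓝 x₀] fun x => ‖x - x₀‖ :=
      ((Asymptotics.isBigO_pi.1 e1) j).norm_right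
    have := e2.mul_isBigO e3
    simpa using this
  have h2 : HasFDerivAt (fun x => x - B x₀ *ᵥ F x)
      (LinearMap.toContinuousLinearMap (Matrix.toLin' (1 - B x₀ * M))) x₀ := by
    have e1 := (hasFDerivAt_id (𝕜 := ℝ) x₀).sub
      ((LinearMap.toContinuousLinearMap (Matrix.toLin' (B x₀))).hasFDerivAt.comp x₀ hF)
    refine e1.congr_fderiv ?_
    ext1 v
    simp
  refine HasFDerivAt.of_isLittleO ((h2.isLittleO.sub h1).congr_left fun x => ?_)
  simp only [hF0, Matrix.mulVec_zero]
  abel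

/-- Without a solution the default value is the zero matrix, which is not invertible when `m > 0`;
for `m = 0` a solution exists trivially. -/
theorem isFundamentalMatrix_variationalSolution {α T : ℝ}
    {f : ℝ → (Fin m → ℝ) → (Fin m → ℝ)} {ρ : Fin m → ℝ}
    (h : IsUnit (variationalSolution α T f ρ T)) :
    IsFundamentalMatrix α T (fun t => jacobian (f t) (ivpSolution α T f ρ t))
      (variationalSolution α T f ρ) := by
  have hex : ∃ Φ, IsFundamentalMatrix α T
      (fun t => jacobian (f t) (ivpSolution α T f ρ t)) Φ := by
    by_contra hne
    rcases Nat.eq_zero_or_pos m with rfl | hm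
    · exact hne ⟨fun _ => 1, rfl, fun i => i.elim0⟩
    · have : Nonempty (Fin m) := ⟨⟨0, hm⟩⟩
      rw [variationalSolution, dif_neg hne] at h
      exact not_isUnit_zero h
  rw [variationalSolution, dif_pos hex]
  exact hex.choose_spec

end SimplifiedNewton

end FracTVP

theorem theorem5 {m : ℕ} (α T : ℝ) (hα0 : 0 < α) (hα1 : α < 1) (hT : 0 < T)
    (f : ℝ → (Fin m → ℝ) → (Fin m → ℝ)) (η ρstar : Fin m → ℝ)
    -- the terminal value problem has a solution `ystar`, with initial value `ρstar`
    (ystar : ℝ → (Fin m → ℝ))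
    (hsol : FracTVP.IsIVPSolution α T f ρstar ystar) (hterm : ystar T = η)
    -- `f` is continuously differentiable near the solution
    (hf : FracTVP.ContDiffNearSolution T f ystar)
    -- `ξ ↦ Φ(T, ξ)⁻¹` exists and is differentiable near `ρstar`
    (hΦ : ∀ᶠ ξ in 𝓝 ρstar, IsUnit (FracTVP.variationalSolution α T f ξ T) ∧
      ∀ i j, DifferentiableAt ℝ
        (fun ζ => (FracTVP.variationalSolution α T f ζ T)⁻¹ i j) ξ)
    -- the approximation `Φhat ξ` of `Φ(T, ξ)` is continuously invertible near `ρstar`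
    (Φhat : (Fin m → ℝ) → Matrix (Fin m) (Fin m) ℝ)
    (hΦhat : ∀ᶠ ξ in 𝓝 ρstar, IsUnit (Φhat ξ) ∧ ContinuousAt (fun ζ => (Φhat ζ)⁻¹) ξ)
    (hrad : FracTVP.realMatrixSpectralRadius
      (1 - (Φhat ρstar)⁻¹ * FracTVP.variationalSolution α T f ρstar T) < 1) :
    ∃ U ∈ 𝓝 ρstar, ∀ ρ : ℕ → (Fin m → ℝ), ρ 0 ∈ U →
      (∀ l, ρ (l + 1) =
        ρ l - (Φhat (ρ l))⁻¹ *ᵥ (FracTVP.ivpSolution α T f (ρ l) T - η)) →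
      (∀ l, FracTVP.UniquelySolvable α T f (ρ l) ∧ IsUnit (Φhat (ρ l))) ∧
        Tendsto ρ atTop (𝓝 ρstar) := by
  have hsolv := FracTVP.eventually_uniquelySolvable hα0 hα1 hT hsol hf
  have huniq := hsolv.self_of_nhds
  have hstar : FracTVP.ivpSolution α T f ρstar T - η = 0 := by
    rw [huniq.eqOn huniq.isIVPSolution hsol ⟨hT.le, le_rfl⟩, hterm, sub_self]
  have hF := (FracTVP.hasFDerivAt_terminal_value hα0 hα1 hT hsol hf
    (FracTVP.isFundamentalMatrix_variationalSolution hΦ.self_of_nhds.1)).sub_const η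
  have hG := FracTVP.hasFDerivAt_sub_mulVec (B := fun ξ => (Φhat ξ)⁻¹) hF hstar
    hΦhat.self_of_nhds.2
  obtain ⟨k, hk, hA⟩ :=
    FracTVP.exists_norm_pow_lt_one_of_realMatrixSpectralRadius_lt_one hrad
  have hev := FracTVP.eventually_iterate_tendsto_of_norm_pow_lt_one hG (by simp [hstar]) hk hA
    (hsolv.and (hΦhat.mono fun _ h => h.1))
  refine ⟨_, hev, fun ρ h0 hρ => ?_⟩
  set G := fun ξ => ξ - (Φhat ξ)⁻¹ *ᵥ (FracTVP.ivpSolution α T f ξ T - η) with hGdef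
  -- The recurrence makes `ρ` the orbit of `G`, along which solvability and invertibility were
  -- carried as the predicate `P`.
  have hit : ∀ l, ρ l = G^[l] (ρ 0) := by
    intro l
    induction l with
    | zero => rfl
    | succ l ih => rw [Function.iterate_succ_apply', ← ih, hρ l]
  obtain ⟨h1, h2⟩ := h0
  refine ⟨fun l => ?_, ?_⟩
  · rw [hit l]; exact h1 l
  · rw [funext hit]; exact h2
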